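/- Notation. In a Maker-Breaker game with a finite board $X$ and a family $\mathcal F \subseteq 2^X$ of winning sets, two players, Maker and Breaker, alternately claim one unclaimed element of $X$ at a time until all elements are claimed; Maker wins if he has claimed all elements of some set in $\mathcal F$, otherwise Breaker wins. In the Hamiltonicity game on a graph $G$, the board is $E(G)$ and the winning sets are the edge sets of the Hamiltonian cycles of $G$. In the Fixed Hamiltonian Path game on a graph $H$ with two fixed vertices $u, v$, the board is $E(H)$ and the winning sets are the edge sets of the Hamiltonian paths of $H$ with endpoints $u$ and $v$. Let $\hat m(n)$ be the smallest number of edges of a graph on $n$ vertices on whose edge set Maker, moving first, has a winning strategy in the Hamiltonicity game. Theorem. For every $n \ge 336$ we have $\hat m(n) \le 4n$. More precisely, write $n = 7m + r$ with $0 \le r < 7$. There are a partition of a set of $n$ vertices into $V_0, \dots, V_{m-1}$ with $|V_i| = 8$ for $i < r$ and $|V_i| = 7$ for $r \le i < m$, and vertices $a_i \in V_i$, such that the following holds, where indices are read modulo $m$ and $W_i = \{a_{i-1}\} \cup V_i$. Let $G_n$ be the graph on these $n$ vertices in which two distinct vertices $x, y$ are adjacent if and only if there is an $i$ with $x, y \in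 W_i$ and $\{x, y\} \ne \{a_{i-1}, a_i\}$ (a cycle of cliques, in which consecutive cliques share a vertex and each clique lacks the edge between its two shared vertices). Then: 1. each $W_i$ has $8$ or $9$ vertices, and $G_n$ has at most $4n$ edges; 2. for every $i$, Maker, moving second, wins the Fixed Hamiltonian Path game on $G_n[W_i]$ with fixed vertices $a_{i-1}$ and $a_i$; 3. Maker, moving first on the board $E(G_n)$, can win all these Fixed Hamiltonian Path games in parallel: he can ensure that at the end his edges contain, for every $i$, a Hamiltonian path of $G_n[W_i]$ with endpoints $a_{i-1}$ and $a_i$; 4. Maker, moving first, wins the Hamiltonicity game on $E(G_n)$. -/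

import Mathlib

/-- The two players of a Maker-Breaker positional game. -/
inductive Player
  | maker
  | breaker

/-- `MakerWins F p U M` says that Maker has a winning strategy in the Maker-Breaker game with family
of winning sets `F`, from the position in which player `p` is to move, `U` is the set of unclaimed
elements of the board and `M` is the set of elements that Maker has claimed so far.
The players alternately claim one unclaimed element at a time until all of the elements are
claimed, and Maker wins if he has then claimed all elements of some winning set.
A derivation is a (finite) strategy tree for Maker: he names one move at each of his turns, and
answers every possible move of Breaker. -/
inductive MakerWins {α : Type*} [DecidableEq α] (F : Set (Finset α)) :
    Player → Finset α → Finset α → Prop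
  | game_over (p : Player) (M A : Finset α) (hA : A ∈ F) (hAM : A ⊆ M) : MakerWins F p ∅ M
  | maker_move (U M : Finset α) (x : α) (hx : x ∈ U)
      (h : MakerWins F Player.breaker (U.erase x) (insert x M)) : MakerWins F Player.maker U M
  | breaker_move (U M : Finset α) (hU : U.Nonempty)
      (h : ∀ x ∈ U, MakerWins F Player.maker (U.erase x) M) : MakerWins F Player.breaker U M

/-- Maker wins the positional game `(X, F)` as first player. -/
def MakerWinsFirst {α : Type*} [DecidableEq α] (X : Finset α) (F : Set (Finset α)) : Prop :=
  MakerWins F Player.maker X ∅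

/-- Maker wins the positional game `(X, F)` as second player. -/
def MakerWinsSecond {α : Type*} [DecidableEq α] (X : Finset α) (F : Set (Finset α)) : Prop :=
  MakerWins F Player.breaker X ∅

section Games

variable {V : Type*} [Fintype V] [DecidableEq V]

/-- The edge set `E(G)`, as a finite board. -/
noncomputable def edgeBoard (G : SimpleGraph V) : Finset (Sym2 V) :=
  (Set.toFinite G.edgeSet).toFinset

/-- The board `E_G(W)`: the edges of `G` with both endpoints in `W`, that is, the edges of `G[W]`. -/
noncomputable def edgeBoardOn (G : SimpleGraph V) (W : Finset V) : Finset (Sym2 V) :=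
  (Set.toFinite {e : Sym2 V | e ∈ G.edgeSet ∧ ∀ v ∈ e, v ∈ W}).toFinset

/-- The edge sets of all Hamiltonian cycles of `G`: the winning sets of the Hamiltonicity game. -/
def hamCycleSets (G : SimpleGraph V) : Set (Finset (Sym2 V)) :=
  {A | ∃ (v : V) (p : G.Walk v v), p.IsHamiltonianCycle ∧ p.edges.toFinset = A}

/-- The edge sets of all Hamiltonian paths of `G[W]` with endpoints `u` and `v`: the winning sets
of the Fixed Hamiltonian Path game on `G[W]`. -/
def fixedHamPathSets (G : SimpleGraph V) (W : Finset V) (u v : V) : Set (Finset (Sym2 V)) :=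
  {A | ∃ p : G.Walk u v, p.IsPath ∧ p.support.toFinset = W ∧ p.edges.toFinset = A}

/-- Maker, as first player, wins the Hamiltonicity game played on the edges of `G`. -/
def MakerWinsHam (G : SimpleGraph V) : Prop :=
  MakerWinsFirst (edgeBoard G) (hamCycleSets G)

end Games

/-- `mHat n` is the smallest number of edges of a graph on `n` vertices on whose edges Maker, as
first player, wins the Hamiltonicity game. -/
noncomputable def mHat (n : ℕ) : ℕ :=
  sInf {k | ∃ G : SimpleGraph (Fin n), MakerWinsHam G ∧ G.edgeSet.ncard = k}

/-- The data of a cycle of cliques on `n = 7 m + r` vertices, where `m = n / 7` and `r = n % 7`: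
a partition of the vertices into `V 0, …, V (m - 1)`, the first `r` of size `8` and the others of
size `7`, and a vertex `a i` in every `V i`. Indices are read modulo `m`. -/
structure CliqueCycle (n : ℕ) where
  /-- The parts of the vertex partition. -/
  V : ZMod (n / 7) → Finset (Fin n)
  /-- The chosen vertices, one in every part. -/
  a : ZMod (n / 7) → Fin n
  disjoint : ∀ i j, i ≠ j → Disjoint (V i) (V j)
  cover : ∀ v, ∃ i, v ∈ V i
  card_V : ∀ i, (V i).card = if i.val < n % 7 then 8 else 7
  a_mem : ∀ i, a i ∈ V i

namespace CliqueCycle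

variable {n : ℕ} (C : CliqueCycle n)

/-- The vertex set of the `i`-th clique; it shares `a (i - 1)` with the previous clique and `a i`
with the next one. -/
def W (i : ZMod (n / 7)) : Finset (Fin n) := insert (C.a (i - 1)) (C.V i)

/-- The union of the cliques on the sets `W i`, where the `i`-th clique lacks the edge between its
two shared vertices `a (i - 1)` and `a i`. -/
def graph : SimpleGraph (Fin n) where
  Adj u v := u ≠ v ∧ ∃ i, u ∈ C.W i ∧ v ∈ C.W i ∧ s(u, v) ≠ s(C.a (i - 1), C.a i)
  symm := ⟨by
    rintro u v ⟨h, i, hu, hv, he⟩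
    exact ⟨h.symm, i, hv, hu, by rwa [Sym2.eq_swap]⟩⟩
  loopless := ⟨fun _ h => h.1 rfl⟩

/-- The sets of edges that contain, for every `i`, a Hamiltonian path of the `i`-th clique between
its two shared vertices: Maker's goal when he plays all Fixed Hamiltonian Path games in parallel. -/
def parallelSets : Set (Finset (Sym2 (Fin n))) :=
  {A | ∀ i, ∃ B ∈ fixedHamPathSets C.graph (C.W i) (C.a (i - 1)) (C.a i), B ⊆ A}

end CliqueCycle

namespace MakerWins

variable {α : Type*} [DecidableEq α]

/-- Once Maker owns a winning set, he wins. -/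
theorem of_subset {F : Set (Finset α)} {A : Finset α} (hA : A ∈ F) (U : Finset α) :
    ∀ (p : Player) (M : Finset α), A ⊆ M → MakerWins F p U M := by
  induction U using Finset.strongInduction with
  | H U ih =>
    intro p M hAM
    rcases U.eq_empty_or_nonempty with rfl | hU
    · exact .game_over p M A hA hAM
    · cases p with
      | maker =>
        obtain ⟨x, hx⟩ := hU
        exact .maker_move U M x hx (ih _ (Finset.erase_ssubset hx) _ _
          (hAM.trans (Finset.subset_insert _ _)))
      | breaker =>
        exact .breaker_move U M hU fun x hx => ih _ (Finset.erase_ssubset hx) _ _ hAM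

/-- When no element is left, Maker owns a winning set. -/
theorem exists_subset {F : Set (Finset α)} {p : Player} {U M : Finset α}
    (h : MakerWins F p U M) (hU : U = ∅) : ∃ A ∈ F, A ⊆ M := by
  cases h with
  | game_over _ _ A hA hAM => exact ⟨A, hA, hAM⟩
  | maker_move _ _ x hx h => simp [hU] at hx
  | breaker_move _ _ hne h => simp [hU] at hne

/-- Monotonicity: Maker still wins when free elements are added or given to him, when he may move
out of turn, and when the winning sets are completed by a set `T` that he already owns. -/
theorem mono_aux {F F' : Set (Finset α)} {T : Finset α}
    (hF : ∀ A ∈ F, ∃ B ∈ F', B ⊆ A ∪ T) {p : Player} {U M : Finset α}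
    (h : MakerWins F p U M) :
    ∀ U' M' : Finset α, U ⊆ U' ∪ M' → M ⊆ M' → T ⊆ M' →
      MakerWins F' .maker U' M' ∧ (p = .breaker → MakerWins F' .breaker U' M') := by
  induction h with
  | game_over p M A hA hAM =>
    intro U' M' _ hM hT
    obtain ⟨B, hB, hBA⟩ := hF A hA
    have hBM : B ⊆ M' := hBA.trans (Finset.union_subset (hAM.trans hM) hT)
    exact ⟨of_subset hB _ _ _ hBM, fun _ => of_subset hB _ _ _ hBM⟩
  | maker_move U M x hx _ ih =>
    intro U' M' hU hM hT
    refine ⟨?_, fun h => by cases h⟩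
    by_cases hxM : x ∈ M'
    · refine (ih U' M' ((Finset.erase_subset _ _).trans hU) ?_ hT).1
      exact Finset.insert_subset hxM hM
    · have hxU : x ∈ U' := by
        have := hU hx
        simp only [Finset.mem_union, hxM, or_false] at this
        exact this
      refine .maker_move U' M' x hxU ((ih _ _ ?_ (Finset.insert_subset_insert _ hM)
        (hT.trans (Finset.subset_insert _ _))).2 rfl)
      intro y hy
      have := hU (Finset.mem_of_mem_erase hy)
      simp only [Finset.mem_union, Finset.mem_erase, Finset.mem_insert] at this ⊢
      tauto
  | breaker_move U M hne _ ih =>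
    intro U' M' hU hM hT
    obtain ⟨y, hy⟩ := hne
    refine ⟨(ih y hy U' M' ((Finset.erase_subset _ _).trans hU) hM hT).1, fun _ => ?_⟩
    rcases U'.eq_empty_or_nonempty with rfl | hU'
    · obtain ⟨A, hA, hAM⟩ :=
        (ih y hy ∅ M' ((Finset.erase_subset _ _).trans hU) hM hT).1.exists_subset rfl
      exact .game_over _ _ A hA hAM
    · refine .breaker_move _ _ hU' fun x hx => ?_
      by_cases hxU : x ∈ U
      · refine (ih x hxU _ _ ?_ hM hT).1
        intro z hz
        have := hU (Finset.mem_of_mem_erase hz)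
        have := Finset.ne_of_mem_erase hz
        simp only [Finset.mem_union, Finset.mem_erase] at *
        tauto
      · refine (ih y hy _ _ ?_ hM hT).1
        intro z hz
        have h1 := hU (Finset.mem_of_mem_erase hz)
        have h2 : z ≠ x := by
          rintro rfl
          exact hxU (Finset.mem_of_mem_erase hz)
        simp only [Finset.mem_union, Finset.mem_erase] at *
        tauto

theorem mono_of_union {F F' : Set (Finset α)} {T : Finset α}
    (hF : ∀ A ∈ F, ∃ B ∈ F', B ⊆ A ∪ T) {p : Player} {U M U' M' : Finset α}
    (h : MakerWins F p U M) (hU : U ⊆ U' ∪ M') (hM : M ⊆ M') (hT : T ⊆ M') :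
    MakerWins F' p U' M' := by
  cases p with
  | maker => exact (h.mono_aux hF U' M' hU hM hT).1
  | breaker => exact (h.mono_aux hF U' M' hU hM hT).2 rfl

theorem mono {F : Set (Finset α)} {p : Player} {U M U' M' : Finset α}
    (h : MakerWins F p U M) (hU : U ⊆ U' ∪ M') (hM : M ⊆ M') : MakerWins F p U' M' :=
  h.mono_of_union (T := ∅) (fun A hA => ⟨A, hA, by simp⟩) hU hM (Finset.empty_subset _)

theorem mono_family {F F' : Set (Finset α)} (hF : ∀ A ∈ F, ∃ B ∈ F', B ⊆ A) {p : Player}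
    {U M : Finset α} (h : MakerWins F p U M) : MakerWins F' p U M :=
  h.mono_of_union (T := ∅) (fun A hA => by simpa using hF A hA) Finset.subset_union_left
    subset_rfl (Finset.empty_subset _)

/-- Maker only ever owns elements of the board. -/
theorem restrict {F : Set (Finset α)} {p : Player} {U M X : Finset α}
    (h : MakerWins F p U M) (hU : U ⊆ X) (hM : M ⊆ X) :
    MakerWins {A | A ∈ F ∧ A ⊆ X} p U M := by
  induction h with
  | game_over p M A hA hAM => exact .game_over p M A ⟨hA, hAM.trans hM⟩ hAM
  | maker_move U M x hx _ ih =>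
    exact .maker_move U M x hx (ih ((Finset.erase_subset _ _).trans hU)
      (Finset.insert_subset (hU hx) hM))
  | breaker_move U M hne _ ih =>
    exact .breaker_move U M hne fun x hx => ih x hx ((Finset.erase_subset _ _).trans hU) hM

/-- Combination of strategies: Breaker to move, and every element that he may claim is avoided by
one of several strategies for Maker as the player to move. -/
theorem breaker_of_forall {F : Set (Finset α)} {ι : Type*} {U M : Finset α} (s : Set ι)
    (hs : s.Nonempty) (S N : ι → Finset α)
    (hwin : ∀ i ∈ s, MakerWins F .maker (S i) (N i)) (hS : ∀ i ∈ s, S i ⊆ U ∪ M)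
    (hN : ∀ i ∈ s, N i ⊆ M) (hU : ∀ x ∈ U, ∃ i ∈ s, x ∉ S i) : MakerWins F .breaker U M := by
  rcases U.eq_empty_or_nonempty with rfl | hne
  · obtain ⟨i, hi⟩ := hs
    obtain ⟨A, hA, hAM⟩ := ((hwin i hi).mono (U' := ∅) (hS i hi) (hN i hi)).exists_subset rfl
    exact .game_over _ _ A hA hAM
  · refine .breaker_move _ _ hne fun x hx => ?_
    obtain ⟨i, hi, hxi⟩ := hU x hx
    refine (hwin i hi).mono ?_ (hN i hi)
    intro y hy
    have h1 := hS i hi hy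
    have h2 : y ≠ x := by
      rintro rfl
      exact hxi hy
    simp only [Finset.mem_union, Finset.mem_erase] at *
    tauto

end MakerWins

/-- Maker plays finitely many games on disjoint boards in parallel, replying to Breaker on the
same board. -/
theorem MakerWins.parallel {α ι : Type*} [DecidableEq α] (F : ι → Set (Finset α))
    (D : ι → Finset α) (hD : ∀ i j, i ≠ j → Disjoint (D i) (D j)) (U : Finset α) :
    ∀ M, (∀ i, MakerWins (F i) .breaker (U ∩ D i) M) →
      MakerWins {A | ∀ i, ∃ B ∈ F i, B ⊆ A} .breaker U M ∧
      MakerWins {A | ∀ i, ∃ B ∈ F i, B ⊆ A} .maker U M := by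
  induction U using Finset.strongInduction with
  | H U ih =>
    intro M h
    have hmaker : MakerWins {A | ∀ i, ∃ B ∈ F i, B ⊆ A} .maker U M := by
      rcases U.eq_empty_or_nonempty with rfl | ⟨x, hx⟩
      · exact .game_over _ _ M (fun i => (h i).exists_subset (by simp)) subset_rfl
      · refine .maker_move _ _ x hx (ih _ (Finset.erase_ssubset hx) _ fun i => ?_).1
        refine (h i).mono ?_ (Finset.subset_insert _ _)
        intro y
        simp only [Finset.mem_union, Finset.mem_inter, Finset.mem_erase, Finset.mem_insert]
        tauto
    refine ⟨?_, hmaker⟩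
    rcases U.eq_empty_or_nonempty with rfl | hne
    · exact .game_over _ _ M (fun i => (h i).exists_subset (by simp)) subset_rfl
    refine .breaker_move _ _ hne fun x hx => ?_
    have hother : ∀ i, x ∉ D i → MakerWins (F i) .breaker (U.erase x ∩ D i) M := by
      intro i hi
      have : U.erase x ∩ D i = U ∩ D i := by
        ext y
        simp only [Finset.mem_inter, Finset.mem_erase]
        constructor
        · tauto
        · rintro ⟨h1, h2⟩
          exact ⟨⟨fun e => hi (e ▸ h2), h1⟩, h2⟩
      rw [this]
      exact h i
    by_cases hxD : ∃ i, x ∈ D i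
    · obtain ⟨i, hi⟩ := hxD
      have hne' : ∀ j, j ≠ i → x ∉ D j := fun j hj hxj =>
        Finset.disjoint_left.1 (hD j i hj) hxj hi
      have hi' : MakerWins (F i) .maker (U.erase x ∩ D i) M := by
        have he : (U ∩ D i).erase x = U.erase x ∩ D i := by
          ext y
          simp only [Finset.mem_inter, Finset.mem_erase]
          tauto
        rw [← he]
        generalize hV : U ∩ D i = V at *
        have hxV : x ∈ V := hV ▸ Finset.mem_inter.2 ⟨hx, hi⟩
        have := h i
        rw [hV] at this
        cases this with
        | game_over _ _ A hA hAM => simp at hxV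
        | breaker_move _ _ _ hall => exact hall x hxV
      generalize hV : U.erase x ∩ D i = V at hi'
      cases hi' with
      | game_over _ _ A hA hAM =>
        refine (ih _ (Finset.erase_ssubset hx) M fun j => ?_).2
        by_cases hj : j = i
        · subst hj
          rw [hV]
          exact .game_over _ _ A hA hAM
        · exact hother j (hne' j hj)
      | maker_move _ _ y hy hw =>
        rw [← hV, Finset.mem_inter] at hy
        refine .maker_move _ _ y hy.1 (ih _ ?_ _ fun j => ?_).1
        · exact (Finset.erase_subset _ _).trans_ssubset (Finset.erase_ssubset hx)
        · by_cases hj : j = i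
          · subst hj
            refine hw.mono ?_ subset_rfl
            rw [← hV]
            intro z
            simp only [Finset.mem_union, Finset.mem_inter, Finset.mem_erase]
            tauto
          · refine (hother j (hne' j hj)).mono ?_ (Finset.subset_insert _ _)
            intro z
            simp only [Finset.mem_union, Finset.mem_inter, Finset.mem_erase, Finset.mem_insert]
            tauto
    · push Not at hxD
      exact (ih _ (Finset.erase_ssubset hx) M fun j => hother j (hxD j)).2

section HamiltonianPathGame

variable {V : Type*} [DecidableEq V]

/-- The edges of the complete graph on `W`. -/
def pairs (W : Finset V) : Finset (Sym2 V) := W.offDiag.image fun p => s(p.1, p.2)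

theorem mk_mem_pairs {W : Finset V} {x y : V} :
    s(x, y) ∈ pairs W ↔ x ∈ W ∧ y ∈ W ∧ x ≠ y := by
  simp only [pairs, Finset.mem_image, Finset.mem_offDiag, Prod.exists, Sym2.eq_iff]
  constructor
  · rintro ⟨a, b, ⟨ha, hb, hab⟩, ⟨rfl, rfl⟩ | ⟨rfl, rfl⟩⟩
    · exact ⟨ha, hb, hab⟩
    · exact ⟨hb, ha, hab.symm⟩
  · intro h
    exact ⟨x, y, h, Or.inl ⟨rfl, rfl⟩⟩

/-- The sets of pairs that contain all edges of a path from `u` to `v` with vertex set `W`. -/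
def pathSets (W : Finset V) (u v : V) : Set (Finset (Sym2 V)) :=
  {A | ∃ l : List V, l.Nodup ∧ l.head? = some u ∧ l.getLast? = some v ∧ l.toFinset = W ∧
    l.IsChain fun x y => s(x, y) ∈ A}

theorem pathSets_comm (W : Finset V) (u v : V) : pathSets W u v = pathSets W v u := by
  suffices ∀ u v, pathSets W u v ⊆ pathSets W v u from Set.Subset.antisymm (this u v) (this v u)
  rintro u v A ⟨l, hl, hu, hv, hW, hc⟩
  refine ⟨l.reverse, List.nodup_reverse.2 hl, by simpa using hv, by simpa using hu,
    by simpa using hW, ?_⟩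
  rw [List.isChain_reverse]
  exact hc.imp fun a b h => by rwa [Sym2.eq_swap]

theorem pathSets_insert {W : Finset V} {u v x : V} (hv : v ∈ W) {A : Finset (Sym2 V)}
    (hA : A ∈ pathSets (W.erase v) u x) : A ∪ {s(v, x)} ∈ pathSets W u v := by
  obtain ⟨l, hl, hu, hx, hW, hc⟩ := hA
  have hvl : v ∉ l := by
    rw [← List.mem_toFinset, hW]
    simp
  refine ⟨l ++ [v], ?_, ?_, by simp, ?_, ?_⟩
  · rw [List.nodup_append]
    refine ⟨hl, by simp, ?_⟩
    rintro a ha b hb rfl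
    simp only [List.mem_singleton] at hb
    exact hvl (hb ▸ ha)
  · simp [hu]
  · rw [List.toFinset_append, hW]
    ext y
    by_cases h : y = v <;> simp [h, hv]
  · rw [List.isChain_append]
    refine ⟨hc.imp fun a b h => Finset.mem_union_left _ h, by simp, ?_⟩
    rintro a ha b hb
    rw [hx, Option.mem_some_iff] at ha
    simp only [List.head?_cons, Option.mem_some_iff] at hb
    subst ha hb
    simp [Sym2.eq_swap]

/-- If Maker owns no edge yet and it is his turn, he may fix the last edge of the path and go on
with the remaining vertices. -/
theorem MakerWins.of_erase {W : Finset V} {u v x : V} {U B : Finset (Sym2 V)} (hv : v ∈ W)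
    (hx : s(v, x) ∈ U) (hB : B ⊆ U)
    (h : MakerWins (pathSets (W.erase v) u x) .breaker B ∅) :
    MakerWins (pathSets W u v) .maker U ∅ := by
  refine .maker_move _ _ s(v, x) hx (h.mono_of_union (T := {s(v, x)})
    (fun A hA => ⟨_, pathSets_insert hv hA, subset_rfl⟩) ?_ (by simp) (by simp))
  intro e he
  by_cases h : e = s(v, x)
  · simp [h]
  · simp [h, hB he]

/-- Maker, as second player, can build a Hamiltonian path between any two fixed vertices `u` and
`v` of a clique on `k` vertices, even if the edges `uv` and `xy` are missing. -/
def WinsWithMissingEdge (V : Type*) [DecidableEq V] (k : ℕ) : Prop :=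
  ∀ (W : Finset V) (u v x y : V), W.card = k → [u, v, x, y].Nodup → [u, v, x, y].toFinset ⊆ W →
    MakerWins (pathSets W u v) .breaker (pairs W \ {s(u, v), s(x, y)}) ∅

theorem exists_mem_of_card_lt {W : Finset V} (l : List V) (h : l.length < W.card) :
    ∃ x ∈ W, x ∉ l := by
  by_contra! hl
  have h1 : W ⊆ l.toFinset := fun x hx => List.mem_toFinset.2 (hl x hx)
  have h2 := Finset.card_le_card h1
  have h3 := l.toFinset_card_le
  omega

theorem WinsWithMissingEdge.breaker {k : ℕ} (h : WinsWithMissingEdge V k) (hk : 4 ≤ k)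
    {W : Finset V} {u v : V} (hW : W.card = k) (hu : u ∈ W) (hv : v ∈ W) (huv : u ≠ v) :
    MakerWins (pathSets W u v) .breaker (pairs W \ {s(u, v)}) ∅ := by
  obtain ⟨x, hx, hx'⟩ := exists_mem_of_card_lt (W := W) [u, v] (by simp; omega)
  obtain ⟨y, hy, hy'⟩ := exists_mem_of_card_lt (W := W) [u, v, x] (by simp; omega)
  simp only [List.mem_cons, List.not_mem_nil, or_false, not_or] at hx' hy'
  refine (h W u v x y hW ?_ ?_).mono ?_ subset_rfl
  · simp only [List.nodup_cons, List.mem_cons, List.not_mem_nil, or_false, not_or,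
      not_false_eq_true, List.nodup_nil, and_true]
    tauto
  · simp [Finset.insert_subset_iff, hu, hv, hx, hy]
  · intro e he
    simp only [Finset.mem_sdiff, Finset.mem_insert, Finset.mem_singleton, not_or,
      Finset.union_empty] at he ⊢
    exact ⟨he.1, he.2.1⟩

theorem WinsWithMissingEdge.succ {k : ℕ} (h : WinsWithMissingEdge V k) (hk : 4 ≤ k)
    {W : Finset V} {u v : V} (hW : W.card = k + 1) (hu : u ∈ W) (hv : v ∈ W) (huv : u ≠ v) :
    MakerWins (pathSets W u v) .breaker (pairs W \ {s(u, v)}) ∅ := by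
  have hcard : (W.erase v).card = k := by rw [Finset.card_erase_of_mem hv, hW]; rfl
  have hmem : ∀ {x}, x ∈ W → x ≠ v → x ∈ W.erase v := fun hx hxv =>
    Finset.mem_erase.2 ⟨hxv, hx⟩
  obtain ⟨z, hzW, hz⟩ := exists_mem_of_card_lt (W := W) [u, v] (by simp; omega)
  refine .breaker_move _ _ ⟨s(u, z), ?_⟩ fun e he => ?_
  · simp only [Finset.mem_sdiff, List.mem_cons, List.not_mem_nil, or_false, Finset.mem_singleton,
      not_or, mk_mem_pairs, Sym2.eq_iff] at hz ⊢
    exact ⟨⟨hu, hzW, Ne.symm hz.1⟩, fun h => hz.2 h.2, fun h => huv h.1⟩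
  -- Maker fixes the edge `vx`, where `ux` is useless for him afterwards
  have key : ∀ {x}, x ∈ W → x ≠ u → x ≠ v → e ≠ s(v, x) → (u ∈ e → e = s(u, x) ∨ v ∈ e) →
      (u ∈ e ∨ v ∈ e) →
      MakerWins (pathSets W u v) .maker ((pairs W \ {s(u, v)}).erase e) ∅ := by
    intro x hx hxu hxv hne h1 h2
    refine .of_erase hv (x := x) (B := pairs (W.erase v) \ {s(u, x)}) ?_ ?_
      (h.breaker hk hcard (hmem hu huv) (hmem hx hxv) hxu.symm)
    · simp only [Finset.mem_erase, Finset.mem_sdiff, mk_mem_pairs, Finset.mem_singleton,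
        Sym2.eq_iff]
      exact ⟨hne.symm, ⟨hv, hx, hxv.symm⟩, by tauto⟩
    · intro f
      induction f with
      | _ a b =>
        simp only [Finset.mem_erase, Finset.mem_sdiff, mk_mem_pairs, Finset.mem_singleton]
        rintro ⟨⟨⟨hav, ha⟩, ⟨hbv, hb⟩, hab⟩, hf⟩
        refine ⟨?_, ⟨ha, hb, hab⟩, ?_⟩
        · rintro rfl
          have hve : v ∉ s(a, b) := by
            rw [Sym2.mem_iff]
            tauto
          tauto
        · rw [Sym2.eq_iff]
          tauto
  by_cases hue : u ∈ e
  · obtain ⟨x, rfl⟩ := Sym2.mem_iff_exists.1 hue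
    simp only [Finset.mem_sdiff, mk_mem_pairs, Finset.mem_singleton] at he
    have hxv : x ≠ v := by
      rintro rfl
      exact he.2 rfl
    refine key he.1.2.1 (Ne.symm he.1.2.2) hxv ?_ (fun _ => Or.inl rfl) (Or.inl (by simp))
    rw [ne_eq, Sym2.eq_iff]
    rintro (⟨h1, -⟩ | ⟨h1, -⟩)
    · exact huv h1
    · exact he.1.2.2 h1
  by_cases hve : v ∈ e
  · obtain ⟨x, rfl⟩ := Sym2.mem_iff_exists.1 hve
    obtain ⟨y, hy, hy'⟩ := exists_mem_of_card_lt (W := W) [u, v, x] (by simp; omega)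
    simp only [List.mem_cons, List.not_mem_nil, or_false, not_or] at hy'
    refine key hy hy'.1 hy'.2.1 ?_ (fun _ => Or.inr hve) (Or.inr hve)
    rw [ne_eq, Sym2.eq_iff]
    tauto
  induction e with
  | _ x y =>
    simp only [Sym2.mem_iff, not_or] at hue hve
    simp only [Finset.mem_sdiff, mk_mem_pairs, Finset.mem_singleton] at he
    obtain ⟨⟨hx, hy, hxy⟩, -⟩ := he
    obtain ⟨w, hw, hw'⟩ := exists_mem_of_card_lt (W := W) [u, v, x, y] (by simp; omega)
    simp only [List.mem_cons, List.not_mem_nil, or_false, not_or] at hw'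
    refine .of_erase hv (x := w) ?_ ?_ (h (W.erase v) u w x y hcard ?_ ?_)
    · simp only [Finset.mem_erase, Finset.mem_sdiff, mk_mem_pairs, Finset.mem_singleton,
        ne_eq, Sym2.eq_iff]
      tauto
    · intro f
      induction f with
      | _ a b =>
        simp only [Finset.mem_erase, Finset.mem_sdiff, mk_mem_pairs, Finset.mem_singleton,
          Finset.mem_insert, ne_eq, Sym2.eq_iff]
        tauto
    · simp only [List.nodup_cons, List.mem_cons, List.not_mem_nil, or_false, not_or,
        not_false_eq_true, List.nodup_nil, and_true]
      tauto
    · have h1 : w ∈ W.erase v := hmem hw hw'.2.1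
      simp [Finset.insert_subset_iff, h1, hu, hx, hy, huv, Ne.symm hve.1, Ne.symm hve.2]

end HamiltonianPathGame

/-- A chain of pairs in `A`, a set of edges of `G`, is a walk that uses only edges in `A`. -/
theorem exists_walk_of_isChain {V : Type*} {G : SimpleGraph V} {A : Finset (Sym2 V)}
    (hA : ∀ e ∈ A, e ∈ G.edgeSet) : ∀ (l : List V) (u v : V), l.head? = some u →
      l.getLast? = some v → (l.IsChain fun x y => s(x, y) ∈ A) →
      ∃ p : G.Walk u v, p.support = l ∧ ∀ e ∈ p.edges, e ∈ A
  | [], _, _, hu, _, _ => by simp at hu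
  | [x], u, v, hu, hv, _ => by
    obtain rfl : x = u := by simpa using hu
    obtain rfl : x = v := by simpa using hv
    exact ⟨.nil, rfl, by simp⟩
  | x :: y :: l, u, v, hu, hv, hc => by
    obtain rfl : x = u := by simpa using hu
    rw [List.isChain_cons_cons] at hc
    obtain ⟨p, hp, hpA⟩ := exists_walk_of_isChain hA (y :: l) y v rfl (by simpa using hv) hc.2
    have hxy : G.Adj x y := hA _ hc.1
    refine ⟨.cons hxy p, by simp [hp], ?_⟩
    intro e he
    rw [SimpleGraph.Walk.edges_cons, List.mem_cons] at he
    rcases he with rfl | he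
    · exact hc.1
    · exact hpA e he

theorem exists_fixedHamPath {V : Type*} [Fintype V] [DecidableEq V] {G : SimpleGraph V}
    {W : Finset V} {u v : V} {A : Finset (Sym2 V)} (hA : A ∈ pathSets W u v)
    (hG : ∀ e ∈ A, e ∈ G.edgeSet) : ∃ B ∈ fixedHamPathSets G W u v, B ⊆ A := by
  obtain ⟨l, hl, hu, hv, hW, hc⟩ := hA
  obtain ⟨p, hp, hpA⟩ := exists_walk_of_isChain hG l u v hu hv hc
  refine ⟨_, ⟨p, ?_, by rw [hp, hW], rfl⟩, fun e he => hpA e (List.mem_toFinset.1 he)⟩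
  rw [SimpleGraph.Walk.isPath_def, hp]
  exact hl

theorem SimpleGraph.Walk.isHamiltonianCycle_of_tail_support {V : Type*} [Fintype V]
    [DecidableEq V] {G : SimpleGraph V} {v : V} (p : G.Walk v v) (hV : 3 ≤ Fintype.card V)
    (hp : p.support.tail.Nodup) (hmem : ∀ x, x ∈ p.support.tail) : p.IsHamiltonianCycle := by
  have hlen : p.length = Fintype.card V := by
    have h1 : p.support.tail.length = p.length := by simp
    have h2 : p.support.tail.toFinset = Finset.univ := by
      ext x
      simp [hmem x]
    rw [← h1, ← List.toFinset_card_of_nodup hp, h2, Finset.card_univ]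
  rw [SimpleGraph.Walk.isHamiltonianCycle_iff_isCycle_and_support_count_tail_eq_one]
  refine ⟨?_, fun a => List.count_eq_one_of_mem hp (hmem a)⟩
  rw [SimpleGraph.Walk.isCycle_iff_isPath_tail_and_le_length]
  refine ⟨?_, by omega⟩
  rw [SimpleGraph.Walk.isPath_def]
  have hn : ¬ p.Nil := by
    rw [SimpleGraph.Walk.not_nil_iff_lt_length]
    omega
  rwa [SimpleGraph.Walk.support_tail_of_not_nil _ hn]

namespace CliqueCycle

variable {n : ℕ} (C : CliqueCycle n)

/-- The board of the `i`-th Fixed Hamiltonian Path game. -/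
def board (i : ZMod (n / 7)) : Finset (Sym2 (Fin n)) :=
  pairs (C.W i) \ {s(C.a (i - 1), C.a i)}

theorem mem_edgeSet_iff {e : Sym2 (Fin n)} : e ∈ C.graph.edgeSet ↔ ∃ i, e ∈ C.board i := by
  induction e with
  | _ x y =>
    simp only [SimpleGraph.mem_edgeSet, graph, board, Finset.mem_sdiff, mk_mem_pairs,
      Finset.mem_singleton]
    constructor
    · rintro ⟨h, i, hx, hy, hne⟩
      exact ⟨i, ⟨hx, hy, h⟩, hne⟩
    · rintro ⟨i, ⟨hx, hy, h⟩, hne⟩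
      exact ⟨h, i, hx, hy, hne⟩

theorem board_subset_edgeBoard (i : ZMod (n / 7)) : C.board i ⊆ edgeBoard C.graph := by
  intro e he
  rw [edgeBoard, Set.Finite.mem_toFinset, mem_edgeSet_iff]
  exact ⟨i, he⟩

theorem board_subset_edgeBoardOn (i : ZMod (n / 7)) :
    C.board i ⊆ edgeBoardOn C.graph (C.W i) := by
  intro e he
  rw [edgeBoardOn, Set.Finite.mem_toFinset]
  refine ⟨C.mem_edgeSet_iff.2 ⟨i, he⟩, ?_⟩
  induction e with
  | _ x y =>
    simp only [board, Finset.mem_sdiff, mk_mem_pairs] at he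
    intro v hv
    rcases Sym2.mem_iff.1 hv with rfl | rfl
    · exact he.1.1
    · exact he.1.2.1

theorem eq_of_mem_of_mem {i j : ZMod (n / 7)} {v : Fin n} (hi : v ∈ C.V i) (hj : v ∈ C.V j) :
    i = j := by
  by_contra h
  exact Finset.disjoint_left.1 (C.disjoint i j h) hi hj

theorem a_injective : Function.Injective C.a := fun i j h =>
  C.eq_of_mem_of_mem (C.a_mem i) (h ▸ C.a_mem j)

theorem sub_one_ne (hn : 2 ≤ n / 7) (i : ZMod (n / 7)) : i - 1 ≠ i := by
  have : Fact (1 < n / 7) := ⟨hn⟩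
  simp

theorem a_sub_one_notMem (hn : 2 ≤ n / 7) (i : ZMod (n / 7)) : C.a (i - 1) ∉ C.V i := fun h =>
  sub_one_ne hn i (C.eq_of_mem_of_mem (C.a_mem _) h)

theorem a_sub_one_mem_W (i : ZMod (n / 7)) : C.a (i - 1) ∈ C.W i := Finset.mem_insert_self _ _

theorem a_mem_W (i : ZMod (n / 7)) : C.a i ∈ C.W i := Finset.mem_insert_of_mem (C.a_mem i)

theorem card_W (hn : 2 ≤ n / 7) (i : ZMod (n / 7)) :
    (C.W i).card = if i.val < n % 7 then 9 else 8 := by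
  rw [W, Finset.card_insert_of_notMem (C.a_sub_one_notMem hn i), C.card_V]
  split_ifs <;> rfl

theorem disjoint_board (hn : 3 ≤ n / 7) (i j : ZMod (n / 7)) (hij : i ≠ j) :
    Disjoint (C.board i) (C.board j) := by
  have two_ne : ∀ k : ZMod (n / 7), k - 1 - 1 ≠ k := by
    intro k h
    have h2 : ((2 : ℕ) : ZMod (n / 7)) = 0 := by
      push_cast
      linear_combination -h
    rw [ZMod.natCast_eq_zero_iff] at h2
    exact absurd (Nat.le_of_dvd two_pos h2) (by omega)
  have common : ∀ v, v ∈ C.W i → v ∈ C.W j →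
      (v = C.a (i - 1) ∧ j = i - 1) ∨ (v = C.a (j - 1) ∧ i = j - 1) := by
    intro v hi hj
    rw [W, Finset.mem_insert] at hi hj
    rcases hi with rfl | hi
    · rcases hj with h | h
      · exact absurd (sub_left_injective (C.a_injective h)) hij
      · exact Or.inl ⟨rfl, C.eq_of_mem_of_mem h (C.a_mem _)⟩
    · rcases hj with rfl | h
      · exact Or.inr ⟨rfl, C.eq_of_mem_of_mem hi (C.a_mem _)⟩
      · exact absurd (C.eq_of_mem_of_mem hi h) hij
  rw [Finset.disjoint_left]
  intro e
  induction e with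
  | _ x y =>
    simp only [board, Finset.mem_sdiff, mk_mem_pairs]
    rintro ⟨⟨hxi, hyi, hxy⟩, -⟩ ⟨⟨hxj, hyj, -⟩, -⟩
    rcases common x hxi hxj with ⟨hx, h1⟩ | ⟨hx, h1⟩ <;>
      rcases common y hyi hyj with ⟨hy, h2⟩ | ⟨hy, h2⟩
    · exact hxy (hx.trans hy.symm)
    · exact two_ne i (by rw [← h1, ← h2])
    · exact two_ne i (by rw [← h2, ← h1])
    · exact hxy (hx.trans hy.symm)

theorem makerWins_board (hn : 2 ≤ n / 7) (h : WinsWithMissingEdge (Fin n) 8)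
    (i : ZMod (n / 7)) :
    MakerWins (fixedHamPathSets C.graph (C.W i) (C.a (i - 1)) (C.a i)) .breaker (C.board i) ∅ := by
  have hne : C.a (i - 1) ≠ C.a i := fun h => sub_one_ne hn i (C.a_injective h)
  have hw : MakerWins (pathSets (C.W i) (C.a (i - 1)) (C.a i)) .breaker (C.board i) ∅ := by
    have hc := C.card_W hn i
    split_ifs at hc
    · exact h.succ (by norm_num) hc (C.a_sub_one_mem_W i) (C.a_mem_W i) hne
    · exact h.breaker (by norm_num) hc (C.a_sub_one_mem_W i) (C.a_mem_W i) hne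
  refine (hw.restrict (X := C.board i) subset_rfl (Finset.empty_subset _)).mono_family ?_
  rintro A ⟨hA, hAX⟩
  exact exists_fixedHamPath hA fun e he => C.mem_edgeSet_iff.2 ⟨i, hAX he⟩

theorem makerWinsSecond (hn : 2 ≤ n / 7) (h : WinsWithMissingEdge (Fin n) 8)
    (i : ZMod (n / 7)) : MakerWinsSecond (edgeBoardOn C.graph (C.W i))
      (fixedHamPathSets C.graph (C.W i) (C.a (i - 1)) (C.a i)) :=
  (C.makerWins_board hn h i).mono
    ((C.board_subset_edgeBoardOn i).trans Finset.subset_union_left) subset_rfl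

theorem makerWinsFirst_parallel (hn : 3 ≤ n / 7) (h : WinsWithMissingEdge (Fin n) 8) :
    MakerWinsFirst (edgeBoard C.graph) C.parallelSets := by
  refine (MakerWins.parallel _ C.board (C.disjoint_board hn) (edgeBoard C.graph) ∅
    fun i => ?_).2
  rw [Finset.inter_eq_right.2 (C.board_subset_edgeBoard i)]
  exact C.makerWins_board (by omega) h i

theorem exists_hamCycle (hn : 2 ≤ n / 7) {A : Finset (Sym2 (Fin n))} (hA : A ∈ C.parallelSets) :
    ∃ B ∈ hamCycleSets C.graph, B ⊆ A := by
  have : NeZero (n / 7) := ⟨by omega⟩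
  have key : ∀ k : ℕ, k ≤ n / 7 → ∃ q : C.graph.Walk (C.a (-1)) (C.a ((k : ZMod (n / 7)) - 1)),
      (∀ e ∈ q.edges, e ∈ A) ∧ q.support.tail.Nodup ∧
      ∀ x, x ∈ q.support.tail ↔ ∃ j < k, x ∈ C.V (j : ZMod (n / 7)) := by
    intro k
    induction k with
    | zero =>
      intro _
      have h0 : C.a (-1) = C.a (((0 : ℕ) : ZMod (n / 7)) - 1) := by simp
      exact ⟨SimpleGraph.Walk.nil.copy rfl h0, by simp, by simp, by simp⟩
    | succ k ih =>
      intro hk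
      obtain ⟨q, hqA, hq, hqV⟩ := ih (by omega)
      obtain ⟨B, ⟨p, hp, hpW, rfl⟩, hB⟩ := hA (k : ZMod (n / 7))
      have hk1 : C.a (k : ZMod (n / 7)) = C.a (((k + 1 : ℕ) : ZMod (n / 7)) - 1) := by simp
      have hsupp : p.support = C.a ((k : ZMod (n / 7)) - 1) :: p.support.tail :=
        p.cons_tail_support.symm
      have hnd := hp.support_nodup
      rw [hsupp, List.nodup_cons] at hnd
      have hpV : ∀ x, x ∈ p.support.tail ↔ x ∈ C.V k := by
        intro x
        have h1 : x ∈ p.support ↔ x ∈ C.W k := by rw [← hpW, List.mem_toFinset]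
        rw [hsupp, List.mem_cons, W, Finset.mem_insert] at h1
        have h2 := C.a_sub_one_notMem hn k
        constructor
        · intro hx
          rcases h1.1 (Or.inr hx) with rfl | h
          · exact absurd hx hnd.1
          · exact h
        · intro hx
          rcases h1.2 (Or.inr hx) with rfl | h
          · exact absurd hx h2
          · exact h
      refine ⟨(q.append p).copy rfl hk1, ?_, ?_, ?_⟩
      · intro e he
        rw [SimpleGraph.Walk.edges_copy, SimpleGraph.Walk.edges_append, List.mem_append] at he
        rcases he with he | he
        · exact hqA e he
        · exact hB (List.mem_toFinset.2 he)
      · rw [SimpleGraph.Walk.support_copy, SimpleGraph.Walk.tail_support_append,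
          List.nodup_append']
        refine ⟨hq, hnd.2, fun x hx hx' => ?_⟩
        obtain ⟨j, hj, hxj⟩ := (hqV x).1 hx
        have hjk := C.eq_of_mem_of_mem hxj ((hpV x).1 hx')
        have h1 := congrArg ZMod.val hjk
        rw [ZMod.val_cast_of_lt (by omega), ZMod.val_cast_of_lt (by omega)] at h1
        omega
      · intro x
        rw [SimpleGraph.Walk.support_copy, SimpleGraph.Walk.tail_support_append, List.mem_append,
          hqV, hpV]
        constructor
        · rintro (⟨j, hj, hx⟩ | hx)
          · exact ⟨j, by omega, hx⟩
          · exact ⟨k, by omega, hx⟩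
        · rintro ⟨j, hj, hx⟩
          rcases Nat.lt_succ_iff_lt_or_eq.1 hj with h | rfl
          · exact Or.inl ⟨j, h, hx⟩
          · exact Or.inr hx
  obtain ⟨q, hqA, hq, hqV⟩ := key (n / 7) le_rfl
  have hcl : C.a (((n / 7 : ℕ) : ZMod (n / 7)) - 1) = C.a (-1) := by simp
  refine ⟨_, ⟨_, q.copy rfl hcl, ?_, rfl⟩, ?_⟩
  · refine SimpleGraph.Walk.isHamiltonianCycle_of_tail_support _ ?_ (by simpa using hq) ?_
    · rw [Fintype.card_fin]
      omega
    · intro x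
      rw [SimpleGraph.Walk.support_copy, hqV]
      obtain ⟨i, hi⟩ := C.cover x
      exact ⟨i.val, i.val_lt, by simpa using hi⟩
  · intro e he
    rw [List.mem_toFinset, SimpleGraph.Walk.edges_copy] at he
    exact hqA e he

theorem makerWinsHam (hn : 3 ≤ n / 7) (h : WinsWithMissingEdge (Fin n) 8) :
    MakerWinsHam C.graph :=
  (C.makerWinsFirst_parallel hn h).mono_family fun _ hA => C.exists_hamCycle (by omega) hA

theorem card_board (hn : 2 ≤ n / 7) (i : ZMod (n / 7)) :
    (C.board i).card = 27 + if i.val < n % 7 then 8 else 0 := by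
  have hne : C.a (i - 1) ≠ C.a i := fun h => sub_one_ne hn i (C.a_injective h)
  rw [board, Finset.card_sdiff_of_subset, Finset.card_singleton, pairs]
  · have := Sym2.card_image_offDiag (C.W i)
    rw [show (fun p : Fin n × Fin n => s(p.1, p.2)) = Sym2.mk.uncurry from rfl]
    rw [this, C.card_W hn]
    split_ifs <;> decide
  · rw [Finset.singleton_subset_iff, mk_mem_pairs]
    exact ⟨C.a_sub_one_mem_W i, C.a_mem_W i, hne⟩

theorem ncard_edgeSet_le (hn : 24 ≤ n / 7) : C.graph.edgeSet.ncard ≤ 4 * n := by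
  have : NeZero (n / 7) := ⟨by omega⟩
  have hsub : C.graph.edgeSet = (Finset.univ.biUnion C.board : Finset _) := by
    ext e
    simp [C.mem_edgeSet_iff]
  rw [hsub, Set.ncard_coe_finset]
  refine Finset.card_biUnion_le.trans ?_
  have hfil : (Finset.univ.filter fun i : ZMod (n / 7) => i.val < n % 7).card ≤ n % 7 := by
    rw [← Finset.card_range (n % 7)]
    refine Finset.card_le_card_of_injOn ZMod.val (fun i hi => ?_)
      (ZMod.val_injective _).injOn
    simpa using hi
  simp only [C.card_board (by omega : 2 ≤ n / 7), Finset.sum_add_distrib, Finset.sum_const,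
    Finset.card_univ, ZMod.card, ← Finset.sum_filter, smul_eq_mul]
  omega

end CliqueCycle

/-- Consecutive intervals of lengths `8` and `7`. -/
theorem exists_cliqueCycle {n : ℕ} (hn : 7 * (n % 7) ≤ n) (hn' : 7 ≤ n) :
    Nonempty (CliqueCycle n) := by
  have : NeZero (n / 7) := ⟨by omega⟩
  let start : ℕ → ℕ := fun k => 7 * k + min k (n % 7)
  have hstart : ∀ i : ZMod (n / 7), start (i.val + 1) ≤ n := by
    intro i
    have := i.val_lt
    simp only [start]
    omega
  have hsucc : ∀ k, start k < start (k + 1) := by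
    intro k
    simp only [start]
    omega
  refine ⟨{
    V := fun i => Finset.univ.filter fun v : Fin n => start i.val ≤ v ∧ v < start (i.val + 1)
    a := fun i => ⟨start i.val, (hsucc _).trans_le (hstart i)⟩
    disjoint := ?_
    cover := ?_
    card_V := ?_
    a_mem := ?_ }⟩
  · intro i j hij
    rw [Finset.disjoint_left]
    intro v hi hj
    simp only [Finset.mem_filter, Finset.mem_univ, true_and, start] at hi hj
    apply hij
    apply ZMod.val_injective
    omega
  · intro v
    have hv := v.2
    obtain ⟨k, hk, h1, h2⟩ : ∃ k < n / 7, start k ≤ v ∧ v < start (k + 1) := by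
      simp only [start]
      by_cases h : (v : ℕ) < 8 * (n % 7)
      · exact ⟨v / 8, by omega, by omega, by omega⟩
      · exact ⟨(v - n % 7) / 7, by omega, by omega, by omega⟩
    refine ⟨(k : ZMod (n / 7)), ?_⟩
    simp only [Finset.mem_filter, Finset.mem_univ, true_and]
    rw [ZMod.val_cast_of_lt hk]
    exact ⟨h1, h2⟩
  · intro i
    have hi := hstart i
    have himg : (Finset.univ.filter fun v : Fin n =>
        start i.val ≤ v ∧ v < start (i.val + 1)).map Fin.valEmbedding =
        Finset.Ico (start i.val) (start (i.val + 1)) := by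
      ext x
      simp only [Finset.mem_map, Finset.mem_filter, Finset.mem_univ, true_and,
        Fin.valEmbedding_apply, Finset.mem_Ico]
      constructor
      · rintro ⟨v, hv, rfl⟩
        exact hv
      · intro hx
        exact ⟨⟨x, by omega⟩, hx, rfl⟩
    rw [← Finset.card_map Fin.valEmbedding, himg, Nat.card_Ico]
    simp only [start]
    split_ifs <;> omega
  · intro i
    simp only [Finset.mem_filter, Finset.mem_univ, true_and]
    exact ⟨le_rfl, hsucc _⟩

/-!
### Certificates for the Fixed Hamiltonian Path game on eight vertices

The vertices are `0, …, 7`, where `0` and `1` are the two fixed ones. Vertex `i` has a weight, such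
that the sum of the weights of the two endpoints determines an edge. A set of edges is stored as the
natural number whose bits at these sums are set. A *pattern* consists of three edge sets `M`, `S`,
`N`, stored at the offsets `0`, `50` and `100` of one number: Maker, as the player to move, wins
if he owns `M` and all edges in `S` are free, and `N` is disjoint from `S`.
-/

namespace PathGame

/-- The edges of the complete graph on eight vertices: bit position and endpoints. -/
def edgeList : List (ℕ × ℕ × ℕ) :=
  [(1, 0, 1), (2, 0, 2), (4, 0, 3), (7, 0, 4), (12, 0, 5), (20, 0, 6), (29, 0, 7),
    (3, 1, 2), (5, 1, 3), (8, 1, 4), (13, 1, 5), (21, 1, 6), (30, 1, 7),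
    (6, 2, 3), (9, 2, 4), (14, 2, 5), (22, 2, 6), (31, 2, 7),
    (11, 3, 4), (16, 3, 5), (24, 3, 6), (33, 3, 7),
    (19, 4, 5), (27, 4, 6), (36, 4, 7), (32, 5, 6), (41, 5, 7), (49, 6, 7)]

/-- The set of all edges. -/
def allEdges : ℕ := 565234498108414

/-- The weights of the vertices. -/
def weight (i : ℕ) : ℕ := [0, 1, 2, 4, 7, 12, 20, 29].getD i 0

/-- The permutation of the vertices with code `r`, which maps `{0, 1}` to itself. -/
def place (r : ℕ) : ℕ → ℕ
  | 0 => Nat.mod (Nat.div r 262144) 2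
  | 1 => Nat.sub 1 (Nat.mod (Nat.div r 262144) 2)
  | 2 => Nat.mod r 8
  | 3 => Nat.mod (Nat.div r 8) 8
  | 4 => Nat.mod (Nat.div r 64) 8
  | 5 => Nat.mod (Nat.div r 512) 8
  | 6 => Nat.mod (Nat.div r 4096) 8
  | _ => Nat.mod (Nat.div r 32768) 8

/-- The union of bit sets. -/
def union (l : List ℕ) : ℕ := l.foldr Nat.lor 0

/-- Moves the bits for one edge to the position of the edge with endpoints of weights `a`, `b`. -/
def moveBit (q c a b : ℕ) : ℕ :=
  Nat.shiftLeft (Nat.land (Nat.shiftRight q c) 1267650600228230527396610048001) (Nat.add a b)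

/-- The image of a pattern under a map of the vertices. -/
def relabel (g : ℕ → ℕ) (q : ℕ) : ℕ :=
  union (edgeList.map fun t => moveBit q t.1 (weight (g t.2.1)) (weight (g t.2.2)))

/-- Whether `g` permutes `0, …, 7`. -/
def isPerm (g : ℕ → ℕ) : Bool :=
  Nat.beq (union ((List.range 8).map fun i => Nat.shiftLeft 1 (g i))) 255

/-- The weights as the digits of a number in base 32, for faster evaluation. -/
def fastWeight (d : ℕ) : ℕ := Nat.mod (Nat.div 1018317375520 (Nat.pow 32 d)) 32

/-- `relabel` with an explicit list of the new weights, for faster evaluation. -/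
def fastRelabel (q w0 w1 w2 w3 w4 w5 w6 w7 : ℕ) : ℕ :=
  Nat.lor (moveBit q 1 w0 w1) <|
    Nat.lor (moveBit q 2 w0 w2) <|
    Nat.lor (moveBit q 4 w0 w3) <|
    Nat.lor (moveBit q 7 w0 w4) <|
    Nat.lor (moveBit q 12 w0 w5) <|
    Nat.lor (moveBit q 20 w0 w6) <|
    Nat.lor (moveBit q 29 w0 w7) <|
    Nat.lor (moveBit q 3 w1 w2) <|
    Nat.lor (moveBit q 5 w1 w3) <|
    Nat.lor (moveBit q 8 w1 w4) <|
    Nat.lor (moveBit q 13 w1 w5) <|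
    Nat.lor (moveBit q 21 w1 w6) <|
    Nat.lor (moveBit q 30 w1 w7) <|
    Nat.lor (moveBit q 6 w2 w3) <|
    Nat.lor (moveBit q 9 w2 w4) <|
    Nat.lor (moveBit q 14 w2 w5) <|
    Nat.lor (moveBit q 22 w2 w6) <|
    Nat.lor (moveBit q 31 w2 w7) <|
    Nat.lor (moveBit q 11 w3 w4) <|
    Nat.lor (moveBit q 16 w3 w5) <|
    Nat.lor (moveBit q 24 w3 w6) <|
    Nat.lor (moveBit q 33 w3 w7) <|
    Nat.lor (moveBit q 19 w4 w5) <|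
    Nat.lor (moveBit q 27 w4 w6) <|
    Nat.lor (moveBit q 36 w4 w7) <|
    Nat.lor (moveBit q 32 w5 w6) <|
    Nat.lor (moveBit q 41 w5 w7) <|
    Nat.lor (moveBit q 49 w6 w7) 0

/-- The relabelled pattern, or `0` if the vertex map is not a permutation. -/
def fastRefer (q d0 d1 d2 d3 d4 d5 d6 d7 : ℕ) : ℕ :=
  bif Nat.beq (Nat.lor (Nat.shiftLeft 1 d0) (Nat.lor (Nat.shiftLeft 1 d1)
      (Nat.lor (Nat.shiftLeft 1 d2) (Nat.lor (Nat.shiftLeft 1 d3) (Nat.lor (Nat.shiftLeft 1 d4)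
      (Nat.lor (Nat.shiftLeft 1 d5) (Nat.lor (Nat.shiftLeft 1 d6)
      (Nat.lor (Nat.shiftLeft 1 d7) 0)))))))) 255
  then fastRelabel q (fastWeight d0) (fastWeight d1) (fastWeight d2) (fastWeight d3)
    (fastWeight d4) (fastWeight d5) (fastWeight d6) (fastWeight d7)
  else 0

/-- The pattern number `k` in a table. -/
def slot (D k : ℕ) : ℕ :=
  Nat.mod (Nat.shiftRight D (Nat.mul 150 k)) 1427247692705959881058285969449495136382746624

/-- The pattern that the reference `r` to a table describes. -/
def refer (D r : ℕ) : ℕ :=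
  fastRefer (slot D (Nat.div r 524288)) (Nat.mod (Nat.div r 262144) 2)
    (Nat.sub 1 (Nat.mod (Nat.div r 262144) 2)) (Nat.mod r 8) (Nat.mod (Nat.div r 8) 8)
    (Nat.mod (Nat.div r 64) 8) (Nat.mod (Nat.div r 512) 8) (Nat.mod (Nat.div r 4096) 8)
    (Nat.mod (Nat.div r 32768) 8)

/-- Evaluates the argument of `k`, and rejects `0`. -/
noncomputable def strict (n : ℕ) (k : ℕ → Bool) : Bool :=
  Nat.rec false (fun m _ => k (Nat.succ m)) n

/-- The union of the patterns in a row of references. -/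
noncomputable def rowUnion (D fuel : ℕ) : ℕ → ℕ :=
  Nat.rec (fun _ => 0) (fun _ ih row => Nat.rec 0 (fun r _ =>
    Nat.lor (refer D (Nat.mod (Nat.succ r) 4294967296))
      (ih (Nat.div (Nat.succ r) 4294967296))) row) fuel

/-- The three edge sets of a pattern. -/
def maskM (a : ℕ) : ℕ := Nat.land a allEdges
def maskS (a : ℕ) : ℕ := Nat.land (Nat.shiftRight a 50) allEdges
def maskN (a : ℕ) : ℕ := Nat.land (Nat.shiftRight a 100) allEdges

/-- The edges that Maker has to own before he claims `x` and combines the strategies whose union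
is `a`: the edges that these strategies need to own, and the edges that they all need to be free. -/
def newM (x a : ℕ) : ℕ :=
  Nat.land (Nat.lor (maskM a) (Nat.land (maskS a) (Nat.xor allEdges (maskN a))))
    (Nat.xor allEdges (Nat.shiftLeft 1 x))

/-- The edges that Maker then needs to be free. -/
def newS (x a : ℕ) : ℕ :=
  Nat.lor (Nat.land (maskS a) (Nat.xor allEdges (newM x a))) (Nat.shiftLeft 1 x)

/-- The pattern that Maker wins by claiming `x`. -/
def newSlot (x a : ℕ) : ℕ :=
  Nat.lor (newM x a) (Nat.lor (Nat.shiftLeft (newS x a) 50)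
    (Nat.shiftLeft (Nat.xor allEdges (newS x a)) 100))

/-- Inclusion of bit sets. -/
def subsetBits (a b : ℕ) : Bool := Nat.beq (Nat.land a b) a

/-- Whether the strategies whose union is `a` show that Maker, as second player, wins on the board
`R`: they need nothing to be owned, and no element of `R` is used by all of them. -/
def rootOk (R a : ℕ) : Bool :=
  and (Nat.beq (maskM a) 0) (and (subsetBits (maskS a) R) (subsetBits R (maskN a)))

/-- Puts a pattern in front of a table. -/
def push (D s : ℕ) : ℕ := Nat.add (Nat.mul D 1427247692705959881058285969449495136382746624) s

/-- Checks a certificate: every row adds a pattern to the table, and the last one shows that Maker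
wins as second player on the board `R`. -/
noncomputable def certifies (R : ℕ) (rows : List ℕ) : ℕ → Bool :=
  List.rec (fun _ => false) (fun row rest ih D =>
    strict (rowUnion D 28 (Nat.div row 64)) fun a =>
      List.rec (rootOk R a)
        (fun _ _ _ => cond (subsetBits (Nat.shiftLeft 1 (Nat.mod row 64)) allEdges)
          (strict (push D (newSlot (Nat.mod row 64) a)) ih) false) rest) rows

theorem testBit_union (l : List ℕ) (k : ℕ) :
    (union l).testBit k = true ↔ ∃ a ∈ l, a.testBit k = true := by
  induction l with
  | nil => simp [union]
  | cons a l ih =>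
    have : union (a :: l) = a ||| union l := rfl
    rw [this, Nat.testBit_or, Bool.or_eq_true, ih]
    simp

theorem edgeList_lt : ∀ t ∈ edgeList, t.1 < 50 ∧ t.2.1 < 8 ∧ t.2.2 < 8 ∧ t.2.1 ≠ t.2.2 ∧
    allEdges.testBit t.1 = true := by decide

theorem eq_of_edge_eq : ∀ t ∈ edgeList, ∀ s ∈ edgeList,
    s(t.2.1, t.2.2) = s(s.2.1, s.2.2) → t = s := by decide

theorem testBit_allEdges_of_le {c : ℕ} (hc : 50 ≤ c) : allEdges.testBit c = false :=
  Nat.testBit_lt_two_pow (lt_of_lt_of_le (by decide : allEdges < 2 ^ 50)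
    (Nat.pow_le_pow_right two_pos hc))

theorem exists_edge_of_testBit {k : ℕ} (h : allEdges.testBit k = true) :
    ∃ t ∈ edgeList, t.1 = k := by
  have hk : k < 50 := by
    by_contra hk
    rw [testBit_allEdges_of_le (by omega)] at h
    cases h
  have key : ∀ k < 50, allEdges.testBit k = true → ∃ t ∈ edgeList, t.1 = k := by decide
  exact key k hk h

theorem exists_edge : ∀ i < 8, ∀ j < 8, i ≠ j →
    ∃ t ∈ edgeList, t.1 = weight i + weight j ∧ s(t.2.1, t.2.2) = s(i, j) := by decide

theorem eq_of_code_eq : ∀ t ∈ edgeList, ∀ s ∈ edgeList, t.1 = s.1 → t = s := by decide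

theorem testBit_moveBit {q c a b k o : ℕ} (hab : a + b < 50) (hk : k < 50)
    (ho : o = 0 ∨ o = 50 ∨ o = 100) :
    (moveBit q c a b).testBit (k + o) = true ↔ k = a + b ∧ q.testBit (c + o) = true := by
  have hK : ∀ i, (1267650600228230527396610048001 : ℕ).testBit i = true ↔
      i = 0 ∨ i = 50 ∨ i = 100 := by
    intro i
    have h1 : (1267650600228230527396610048001 : ℕ) = 2 ^ 0 ||| (2 ^ 50 ||| 2 ^ 100) := by decide
    rw [h1, Nat.testBit_or, Nat.testBit_or, Nat.testBit_two_pow, Nat.testBit_two_pow,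
      Nat.testBit_two_pow]
    simp only [Bool.or_eq_true, decide_eq_true_eq]
    omega
  have h : moveBit q c a b =
      ((q >>> c) &&& 1267650600228230527396610048001) <<< (a + b) := rfl
  rw [h, Nat.testBit_shiftLeft, Nat.testBit_and, Nat.testBit_shiftRight]
  simp only [Bool.and_eq_true, decide_eq_true_eq, hK]
  constructor
  · rintro ⟨h1, h2, h3⟩
    have : k = a + b := by omega
    subst this
    refine ⟨rfl, ?_⟩
    rwa [Nat.add_sub_cancel_left] at h2
  · rintro ⟨rfl, h2⟩
    rw [Nat.add_sub_cancel_left]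
    exact ⟨by omega, h2, ho⟩

variable {V : Type*} [DecidableEq V]

/-- The edges in the set at offset `o` of the pattern `q`, when vertex `i` is called `f i`. -/
def edges (f : ℕ → V) (o q : ℕ) : Finset (Sym2 V) :=
  (edgeList.toFinset.filter fun t => q.testBit (t.1 + o) = true).image
    fun t => s(f t.2.1, f t.2.2)

theorem mem_edges {f : ℕ → V} {o q : ℕ} {e : Sym2 V} :
    e ∈ edges f o q ↔ ∃ t ∈ edgeList, q.testBit (t.1 + o) = true ∧ s(f t.2.1, f t.2.2) = e := by
  simp [edges, and_assoc]

/-- `f` names the eight vertices in `W`, the fixed ones being `u` and `v`. -/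
structure IsLabeling (W : Finset V) (u v : V) (f : ℕ → V) : Prop where
  injOn : Set.InjOn f (Finset.range 8)
  image_eq : (Finset.range 8).image f = W
  ends : f 0 = u ∧ f 1 = v ∨ f 0 = v ∧ f 1 = u

theorem IsLabeling.edge_injective {W : Finset V} {u v : V} {f : ℕ → V} (hf : IsLabeling W u v f)
    {t s : ℕ × ℕ × ℕ} (ht : t ∈ edgeList) (hs : s ∈ edgeList)
    (h : s(f t.2.1, f t.2.2) = s(f s.2.1, f s.2.2)) : t = s := by
  apply eq_of_edge_eq t ht s hs
  obtain ⟨-, h1, h2, -, -⟩ := edgeList_lt t ht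
  obtain ⟨-, h3, h4, -, -⟩ := edgeList_lt s hs
  have inj : ∀ {a b}, a < 8 → b < 8 → f a = f b → a = b := fun ha hb hab =>
    hf.injOn (by simpa using ha) (by simpa using hb) hab
  rw [Sym2.eq_iff] at h ⊢
  rcases h with ⟨h5, h6⟩ | ⟨h5, h6⟩
  · exact Or.inl ⟨inj h1 h3 h5, inj h2 h4 h6⟩
  · exact Or.inr ⟨inj h1 h4 h5, inj h2 h3 h6⟩

theorem IsLabeling.mem_edges_iff {W : Finset V} {u v : V} {f : ℕ → V} (hf : IsLabeling W u v f)
    {t : ℕ × ℕ × ℕ} (ht : t ∈ edgeList) {o q : ℕ} :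
    s(f t.2.1, f t.2.2) ∈ edges f o q ↔ q.testBit (t.1 + o) = true := by
  rw [mem_edges]
  constructor
  · rintro ⟨s, hs, hq, h⟩
    rwa [← hf.edge_injective hs ht h]
  · intro h
    exact ⟨t, ht, h, rfl⟩

theorem edges_relabel {g : ℕ → ℕ} (hg : Set.MapsTo g (Finset.range 8) (Finset.range 8))
    (hg' : Set.InjOn g (Finset.range 8)) (f : ℕ → V) {o : ℕ} (ho : o = 0 ∨ o = 50 ∨ o = 100)
    (q : ℕ) : edges f o (relabel g q) = edges (f ∘ g) o q := by
  have hedge : ∀ t ∈ edgeList, ∃ s ∈ edgeList, s.1 = weight (g t.2.1) + weight (g t.2.2) ∧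
      s(f s.2.1, f s.2.2) = s(f (g t.2.1), f (g t.2.2)) := by
    intro t ht
    obtain ⟨-, h1, h2, h3, -⟩ := edgeList_lt t ht
    have h4 := hg (by simpa using h1 : t.2.1 ∈ (Finset.range 8 : Set ℕ))
    have h5 := hg (by simpa using h2 : t.2.2 ∈ (Finset.range 8 : Set ℕ))
    simp only [Finset.coe_range, Set.mem_Iio] at h4 h5
    obtain ⟨s, hs, hs1, hs2⟩ := exists_edge _ h4 _ h5 fun h =>
      h3 (hg' (by simpa using h1) (by simpa using h2) h)
    exact ⟨s, hs, hs1, by simpa using congrArg (Sym2.map f) hs2⟩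
  ext e
  simp only [mem_edges, relabel, testBit_union, List.mem_map]
  constructor
  · rintro ⟨s, hs, ⟨_, ⟨t, ht, rfl⟩, hb⟩, rfl⟩
    obtain ⟨s', hs', h1, h2⟩ := hedge t ht
    rw [testBit_moveBit (h1 ▸ (edgeList_lt s' hs').1) (edgeList_lt s hs).1 ho] at hb
    obtain rfl := eq_of_code_eq s hs s' hs' (hb.1.trans h1.symm)
    exact ⟨t, ht, hb.2, h2.symm⟩
  · rintro ⟨t, ht, hq, rfl⟩
    obtain ⟨s, hs, h1, h2⟩ := hedge t ht
    refine ⟨s, hs, ⟨_, ⟨t, ht, rfl⟩, ?_⟩, h2⟩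
    rw [testBit_moveBit (h1 ▸ (edgeList_lt s hs).1) (edgeList_lt s hs).1 ho]
    exact ⟨h1, hq⟩

theorem isPerm.injOn {g : ℕ → ℕ} (h : isPerm g = true) :
    Set.MapsTo g (Finset.range 8) (Finset.range 8) ∧ Set.InjOn g (Finset.range 8) := by
  have h255 : union ((List.range 8).map fun i => Nat.shiftLeft 1 (g i)) = 255 :=
    Nat.eq_of_beq_eq_true h
  have hbit : ∀ k, (255 : ℕ).testBit k = true ↔ ∃ i < 8, g i = k := by
    intro k
    rw [← h255, testBit_union]
    simp only [List.mem_map, List.mem_range, exists_exists_and_eq_and]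
    refine exists_congr fun i => and_congr_right fun _ => ?_
    rw [show Nat.shiftLeft 1 (g i) = 1 <<< g i from rfl, Nat.one_shiftLeft, Nat.testBit_two_pow]
    simp
  have hmaps : Set.MapsTo g (Finset.range 8) (Finset.range 8) := by
    intro i hi
    have h1 := (hbit (g i)).2 ⟨i, by simpa using hi, rfl⟩
    have h2 : g i < 8 := by
      by_contra h3
      rw [Nat.testBit_lt_two_pow] at h1
      · simp at h1
      · exact lt_of_lt_of_le (by decide : 255 < 2 ^ 8) (Nat.pow_le_pow_right two_pos (by omega))
    simpa using h2
  refine ⟨hmaps, Finset.injOn_of_surjOn_of_card_le g hmaps ?_ le_rfl⟩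
  intro k hk
  have hk8 : k < 8 := by simpa using hk
  have h255k : (255 : ℕ).testBit k = true := by
    interval_cases k <;> decide
  obtain ⟨i, hi, rfl⟩ := (hbit k).1 h255k
  exact ⟨i, by simpa using hi, rfl⟩

theorem IsLabeling.comp {W : Finset V} {u v : V} {f : ℕ → V} (hf : IsLabeling W u v f)
    {r : ℕ} (hr : isPerm (place r) = true) : IsLabeling W u v (f ∘ place r) := by
  obtain ⟨h1, h2⟩ := isPerm.injOn hr
  refine ⟨hf.injOn.comp h2 h1, ?_, ?_⟩
  · rw [← Finset.image_image, ← hf.image_eq]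
    congr 1
    refine Finset.eq_of_subset_of_card_le ?_ ?_
    · intro k hk
      obtain ⟨i, hi, rfl⟩ := Finset.mem_image.1 hk
      exact h1 hi
    · rw [Finset.card_image_of_injOn h2]
  · have h0 : place r 0 = r / 262144 % 2 := rfl
    have h1 : place r 1 = 1 - r / 262144 % 2 := rfl
    simp only [Function.comp_apply, h0, h1]
    rcases Nat.mod_two_eq_zero_or_one (r / 262144) with h | h <;> rw [h]
    · exact hf.ends
    · exact hf.ends.symm.imp (fun h => ⟨h.2, h.1⟩) fun h => ⟨h.2, h.1⟩

/-- The pattern `q` describes a winning position for Maker as the player to move. -/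
structure Winning (W : Finset V) (u v : V) (q : ℕ) : Prop where
  makerWins : ∀ f, IsLabeling W u v f →
    MakerWins (pathSets W u v) .maker (edges f 50 q) (edges f 0 q)
  disjoint : ∀ f, IsLabeling W u v f → Disjoint (edges f 50 q) (edges f 100 q)

theorem Winning.relabel {W : Finset V} {u v : V} {q : ℕ} (hq : Winning W u v q) {r : ℕ}
    (hr : isPerm (place r) = true) : Winning W u v (relabel (place r) q) := by
  obtain ⟨h1, h2⟩ := isPerm.injOn hr
  constructor <;> intro f hf <;> simp only [edges_relabel h1 h2 f, true_or, or_true]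
  · exact hq.makerWins _ (hf.comp hr)
  · exact hq.disjoint _ (hf.comp hr)

theorem fastWeight_eq : ∀ d < 8, fastWeight d = weight d := by decide

theorem refer_eq (D r : ℕ) : refer D r =
    bif isPerm (place r) then relabel (place r) (slot D (Nat.div r 524288)) else 0 := by
  have h8 : ∀ a, Nat.mod a 8 < 8 := fun a => Nat.mod_lt _ (by decide)
  have h2 : Nat.mod (Nat.div r 262144) 2 < 8 :=
    (Nat.mod_lt _ (by decide : 2 > 0)).trans (by decide)
  have h1 : Nat.sub 1 (Nat.mod (Nat.div r 262144) 2) < 8 :=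
    (Nat.sub_le _ _).trans_lt (by decide)
  simp only [refer, fastRefer, fastWeight_eq _ (h8 _), fastWeight_eq _ h2, fastWeight_eq _ h1]
  rfl

theorem relabel_zero (g : ℕ → ℕ) : relabel g 0 = 0 := by
  refine Nat.eq_of_testBit_eq fun k => ?_
  rw [Nat.zero_testBit, Bool.eq_false_iff, ne_eq, relabel, testBit_union]
  simp only [List.mem_map]
  rintro ⟨_, ⟨t, -, rfl⟩, h⟩
  have h0 : ∀ a b, moveBit 0 t.1 a b = 0 := by
    intro a b
    have : moveBit 0 t.1 a b =
      ((0 >>> t.1) &&& 1267650600228230527396610048001) <<< (a + b) := rfl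
    simp [this]
  rw [h0, Nat.zero_testBit] at h
  cases h

theorem refer_winning {W : Finset V} {u v : V} {D : ℕ}
    (hD : ∀ k, slot D k = 0 ∨ Winning W u v (slot D k)) (r : ℕ) :
    refer D r = 0 ∨ Winning W u v (refer D r) := by
  rw [refer_eq]
  cases hr : isPerm (place r) with
  | false => exact Or.inl rfl
  | true =>
    rcases hD (Nat.div r 524288) with h | h
    · left
      rw [h]
      exact relabel_zero _
    · exact Or.inr (h.relabel hr)

theorem strict_eq_true {n : ℕ} {k : ℕ → Bool} (h : strict n k = true) : n ≠ 0 ∧ k n = true := by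
  cases n with
  | zero => cases h
  | succ n => exact ⟨n.succ_ne_zero, h⟩

/-- A row stands for the union of winning patterns. -/
theorem exists_rowUnion {W : Finset V} {u v : V} {D : ℕ}
    (hD : ∀ k, slot D k = 0 ∨ Winning W u v (slot D k)) (fuel row : ℕ) :
    ∃ l : List ℕ, (∀ q ∈ l, Winning W u v q) ∧ rowUnion D fuel row = union l := by
  induction fuel generalizing row with
  | zero => exact ⟨[], by simp, rfl⟩
  | succ fuel ih =>
    cases row with
    | zero => exact ⟨[], by simp, rfl⟩
    | succ row =>
      obtain ⟨l, hl, hu⟩ := ih (Nat.div (Nat.succ row) 4294967296)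
      have h : rowUnion D (fuel + 1) (row + 1) =
          refer D (Nat.mod (Nat.succ row) 4294967296) |||
            rowUnion D fuel (Nat.div (Nat.succ row) 4294967296) := rfl
      rw [h, hu]
      rcases refer_winning hD (Nat.mod (Nat.succ row) 4294967296) with h0 | h0
      · exact ⟨l, hl, by rw [h0, Nat.zero_or]⟩
      · exact ⟨_ :: l, by simpa using ⟨h0, hl⟩, rfl⟩

theorem subsetBits_iff {a b : ℕ} (h : subsetBits a b = true) {k : ℕ}
    (hk : a.testBit k = true) : b.testBit k = true := by
  have h1 : a &&& b = a := Nat.eq_of_beq_eq_true h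
  rw [← h1, Nat.testBit_and, Bool.and_eq_true] at hk
  exact hk.2

section Masks

variable {a c : ℕ}

theorem testBit_maskM (hc : allEdges.testBit c = true) : (maskM a).testBit c = a.testBit c := by
  have : maskM a = a &&& allEdges := rfl
  rw [this, Nat.testBit_and, hc, Bool.and_true]

theorem testBit_maskS (hc : allEdges.testBit c = true) :
    (maskS a).testBit c = a.testBit (c + 50) := by
  have : maskS a = (a >>> 50) &&& allEdges := rfl
  rw [this, Nat.testBit_and, hc, Bool.and_true, Nat.testBit_shiftRight, add_comm]

theorem testBit_maskN (hc : allEdges.testBit c = true) :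
    (maskN a).testBit c = a.testBit (c + 100) := by
  have : maskN a = (a >>> 100) &&& allEdges := rfl
  rw [this, Nat.testBit_and, hc, Bool.and_true, Nat.testBit_shiftRight, add_comm]

theorem testBit_shiftLeft_one {x c : ℕ} : (Nat.shiftLeft 1 x).testBit c = decide (x = c) := by
  rw [show Nat.shiftLeft 1 x = 1 <<< x from rfl, Nat.one_shiftLeft, Nat.testBit_two_pow]

theorem testBit_newM {x : ℕ} (hc : allEdges.testBit c = true) : (newM x a).testBit c =
    ((a.testBit c || (a.testBit (c + 50) && !a.testBit (c + 100))) && !decide (x = c)) := by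
  have : newM x a = (maskM a ||| (maskS a &&& (allEdges ^^^ maskN a))) &&&
    (allEdges ^^^ Nat.shiftLeft 1 x) := rfl
  simp only [this, Nat.testBit_and, Nat.testBit_or, Nat.testBit_xor, testBit_maskM hc,
    testBit_maskS hc, testBit_maskN hc, testBit_shiftLeft_one, hc, Bool.true_xor]

theorem testBit_newS {x : ℕ} (hc : allEdges.testBit c = true) : (newS x a).testBit c =
    ((a.testBit (c + 50) && !(newM x a).testBit c) || decide (x = c)) := by
  have : newS x a = (maskS a &&& (allEdges ^^^ newM x a)) ||| Nat.shiftLeft 1 x := rfl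
  simp only [this, Nat.testBit_and, Nat.testBit_or, Nat.testBit_xor, testBit_maskS hc,
    testBit_shiftLeft_one, hc, Bool.true_xor]

theorem testBit_newM_of_le {x : ℕ} (hc : 50 ≤ c) (hx : x < 50) : (newM x a).testBit c = false := by
  have : newM x a = (maskM a ||| (maskS a &&& (allEdges ^^^ maskN a))) &&&
    (allEdges ^^^ Nat.shiftLeft 1 x) := rfl
  rw [this, Nat.testBit_and, Nat.testBit_xor, testBit_allEdges_of_le hc, testBit_shiftLeft_one]
  simp
  omega

theorem testBit_newS_of_le {x : ℕ} (hc : 50 ≤ c) (hx : x < 50) : (newS x a).testBit c = false := by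
  have h1 : newS x a = (maskS a &&& (allEdges ^^^ newM x a)) ||| Nat.shiftLeft 1 x := rfl
  have h2 : maskS a = (a >>> 50) &&& allEdges := rfl
  rw [h1, h2, Nat.testBit_or, Nat.testBit_and, Nat.testBit_and, testBit_allEdges_of_le hc,
    testBit_shiftLeft_one]
  simp
  omega

theorem testBit_newSlot {x : ℕ} (hx : x < 50) (hc : allEdges.testBit c = true) (hc' : c < 50) :
    (newSlot x a).testBit c = (newM x a).testBit c ∧
    (newSlot x a).testBit (c + 50) = (newS x a).testBit c ∧
    (newSlot x a).testBit (c + 100) = !(newS x a).testBit c := by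
  have : newSlot x a =
      newM x a ||| ((newS x a) <<< 50 ||| (allEdges ^^^ newS x a) <<< 100) := rfl
  simp only [this, Nat.testBit_or, Nat.testBit_shiftLeft, Nat.testBit_xor]
  refine ⟨?_, ?_, ?_⟩
  · have h1 : ¬ 50 ≤ c := by omega
    have h2 : ¬ 100 ≤ c := by omega
    simp [h1, h2]
  · rw [testBit_newM_of_le (by omega) hx]
    have h2 : ¬ 100 ≤ c + 50 := by omega
    simp [h2]
  · rw [testBit_newM_of_le (by omega) hx, testBit_newS_of_le (by omega) hx]
    simp [hc]

end Masks

/-- Maker claims the edge `x` and then combines the strategies for the patterns in `l`. -/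
theorem newSlot_winning {W : Finset V} {u v : V} {l : List ℕ} (hl : ∀ q ∈ l, Winning W u v q)
    (hne : union l ≠ 0) {x : ℕ} (hx : allEdges.testBit x = true) :
    Winning W u v (newSlot x (union l)) := by
  obtain ⟨t, ht, rfl⟩ := exists_edge_of_testBit hx
  have ht50 := (edgeList_lt t ht).1
  have hbit : ∀ s ∈ edgeList, _ := fun s hs =>
    testBit_newSlot (a := union l) (c := s.1) ht50 (edgeList_lt s hs).2.2.2.2 (edgeList_lt s hs).1
  have hM : ∀ s ∈ edgeList, _ := fun s hs =>
    testBit_newM (a := union l) (x := t.1) (edgeList_lt s hs).2.2.2.2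
  have hS : ∀ s ∈ edgeList, _ := fun s hs =>
    testBit_newS (a := union l) (x := t.1) (edgeList_lt s hs).2.2.2.2
  constructor
  · intro f hf
    have hmem : ∀ {s o q}, s ∈ edgeList → (s(f s.2.1, f s.2.2) ∈ edges f o q ↔ _) :=
      fun hs => hf.mem_edges_iff hs
    refine .maker_move _ _ s(f t.2.1, f t.2.2) ?_ ?_
    · rw [hmem ht, (hbit t ht).2.1, hS t ht]
      simp
    refine MakerWins.breaker_of_forall {q | q ∈ l} ?_ (edges f 50) (edges f 0)
      (fun q hq => (hl q hq).makerWins f hf) ?_ ?_ ?_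
    · rcases l with _ | ⟨q, l⟩
      · exact absurd rfl hne
      · exact ⟨q, by simp⟩
    · intro q hq e he
      obtain ⟨s, hs, hb, rfl⟩ := mem_edges.1 he
      have hb' := (testBit_union l _).2 ⟨q, hq, hb⟩
      by_cases hst : s = t
      · simp [hst]
      have hst' : t.1 ≠ s.1 := fun h => hst (eq_of_code_eq t ht s hs h).symm
      rw [Finset.mem_union, Finset.mem_erase, Finset.mem_insert, hmem hs, hmem hs,
        (hbit s hs).2.1, Nat.add_zero, (hbit s hs).1, hS s hs, hb']
      by_cases h : (newM t.1 (union l)).testBit s.1 = true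
      · exact Or.inr (Or.inr h)
      · left
        refine ⟨fun h => hst (hf.edge_injective hs ht h), ?_⟩
        simp [h]
    · intro q hq e he
      obtain ⟨s, hs, hb, rfl⟩ := mem_edges.1 he
      have hb' := (testBit_union l _).2 ⟨q, hq, hb⟩
      by_cases hst : s = t
      · simp [hst]
      have hst' : t.1 ≠ s.1 := fun h => hst (eq_of_code_eq t ht s hs h).symm
      rw [Nat.add_zero] at hb'
      rw [Finset.mem_insert, hmem hs, Nat.add_zero, (hbit s hs).1, hM s hs]
      simp [hb', hst']
    · intro e he
      obtain ⟨hne, he⟩ := Finset.mem_erase.1 he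
      obtain ⟨s, hs, hb, rfl⟩ := mem_edges.1 he
      have hst' : t.1 ≠ s.1 := by
        intro h
        rw [eq_of_code_eq t ht s hs h] at hne
        exact hne rfl
      rw [(hbit s hs).2.1, hS s hs, hM s hs] at hb
      have hN : (union l).testBit (s.1 + 100) = true := by
        by_contra h
        simp only [hst', decide_false, Bool.not_false, Bool.and_true, Bool.or_false] at hb
        cases h1 : (union l).testBit (s.1 + 50) <;> simp [h1] at hb
        exact h hb.2
      obtain ⟨q, hq, hqN⟩ := (testBit_union l _).1 hN
      refine ⟨q, hq, fun h => ?_⟩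
      exact Finset.disjoint_left.1 ((hl q hq).disjoint f hf) h ((hmem hs).2 hqN)
  · intro f hf
    rw [Finset.disjoint_left]
    intro e he he'
    obtain ⟨s, hs, hb, rfl⟩ := mem_edges.1 he
    rw [hf.mem_edges_iff hs, (hbit s hs).2.2, ← (hbit s hs).2.1, hb] at he'
    simp at he'

theorem rootOk_makerWins {W : Finset V} {u v : V} {l : List ℕ} (hl : ∀ q ∈ l, Winning W u v q)
    (hne : union l ≠ 0) {R : ℕ} (h : rootOk R (union l) = true) {f : ℕ → V}
    (hf : IsLabeling W u v f) : MakerWins (pathSets W u v) .breaker (edges f 0 R) ∅ := by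
  rw [rootOk, Bool.and_eq_true, Bool.and_eq_true] at h
  obtain ⟨hM, hS, hN⟩ := h
  have hM0 : maskM (union l) = 0 := Nat.eq_of_beq_eq_true hM
  refine MakerWins.breaker_of_forall {q | q ∈ l} ?_ (edges f 50) (edges f 0)
      (fun q hq => (hl q hq).makerWins f hf) ?_ ?_ ?_
  · rcases l with _ | ⟨q, l⟩
    · exact absurd rfl hne
    · exact ⟨q, by simp⟩
  · intro q hq e he
    obtain ⟨s, hs, hb, rfl⟩ := mem_edges.1 he
    rw [Finset.union_empty, hf.mem_edges_iff hs]
    refine subsetBits_iff hS ?_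
    rw [Nat.add_zero, testBit_maskS (edgeList_lt s hs).2.2.2.2]
    exact (testBit_union l _).2 ⟨q, hq, hb⟩
  · intro q hq e he
    obtain ⟨s, hs, hb, rfl⟩ := mem_edges.1 he
    have h1 : (maskM (union l)).testBit s.1 = true := by
      rw [testBit_maskM (edgeList_lt s hs).2.2.2.2]
      exact (testBit_union l _).2 ⟨q, hq, hb⟩
    simp [hM0] at h1
  · intro e he
    obtain ⟨s, hs, hb, rfl⟩ := mem_edges.1 he
    have h1 := subsetBits_iff hN hb
    rw [Nat.add_zero, testBit_maskN (edgeList_lt s hs).2.2.2.2] at h1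
    obtain ⟨q, hq, hqN⟩ := (testBit_union l _).1 h1
    refine ⟨q, hq, fun h => ?_⟩
    exact Finset.disjoint_left.1 ((hl q hq).disjoint f hf) h ((hf.mem_edges_iff hs).2 hqN)

theorem slot_eq (D k : ℕ) : slot D k = D / 2 ^ (150 * k) % 2 ^ 150 := by
  have : slot D k = (D >>> (150 * k)) % 2 ^ 150 := rfl
  rw [this, Nat.shiftRight_eq_div_pow]

theorem newSlot_lt {x a : ℕ} (hx : x < 50) : newSlot x a < 2 ^ 150 := by
  have h : newSlot x a =
      newM x a ||| ((newS x a) <<< 50 ||| (allEdges ^^^ newS x a) <<< 100) := rfl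
  refine Nat.lt_pow_two_of_testBit _ fun c hc => ?_
  rw [h, Nat.testBit_or, Nat.testBit_or, Nat.testBit_shiftLeft, Nat.testBit_shiftLeft,
    Nat.testBit_xor, testBit_newM_of_le (by omega) hx, testBit_newS_of_le (by omega) hx,
    testBit_newS_of_le (by omega) hx, testBit_allEdges_of_le (by omega)]
  simp

theorem push_eq (D s : ℕ) : push D s = D * 2 ^ 150 + s := by
  have h : (1427247692705959881058285969449495136382746624 : ℕ) = 2 ^ 150 := by norm_num
  rw [← h]
  rfl

theorem slot_push {D s k : ℕ} (hs : s < 2 ^ 150) :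
    slot (push D s) k = if k = 0 then s else slot D (k - 1) := by
  rw [push_eq, slot_eq]
  cases k with
  | zero =>
    rw [Nat.mul_zero, pow_zero, Nat.div_one, Nat.mul_add_mod_self_right, Nat.mod_eq_of_lt hs]
    rfl
  | succ k =>
    rw [Nat.mul_succ, add_comm (150 * k), pow_add, ← Nat.div_div_eq_div_mul,
      Nat.mul_comm D, Nat.mul_add_div (by positivity), Nat.div_eq_of_lt hs, Nat.add_zero]
    simp [slot_eq]

theorem certifies_singleton (R row D : ℕ) :
    certifies R [row] D = strict (rowUnion D 28 (Nat.div row 64)) (rootOk R) := rfl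

theorem certifies_cons_cons (R row row' : ℕ) (rows : List ℕ) (D : ℕ) :
    certifies R (row :: row' :: rows) D = strict (rowUnion D 28 (Nat.div row 64)) fun a =>
      cond (subsetBits (Nat.shiftLeft 1 (Nat.mod row 64)) allEdges)
        (strict (push D (newSlot (Nat.mod row 64) a)) (certifies R (row' :: rows))) false := rfl
theorem certifies_makerWins {W : Finset V} {u v : V} {R : ℕ} (rows : List ℕ) {D : ℕ}
    (hD : ∀ k, slot D k = 0 ∨ Winning W u v (slot D k)) (h : certifies R rows D = true)
    {f : ℕ → V} (hf : IsLabeling W u v f) :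
    MakerWins (pathSets W u v) .breaker (edges f 0 R) ∅ := by
  induction rows generalizing D with
  | nil => cases h
  | cons row rows ih =>
    obtain ⟨l, hl, hu⟩ := exists_rowUnion hD 28 (Nat.div row 64)
    cases rows with
    | nil =>
      rw [certifies_singleton, hu] at h
      obtain ⟨hne, h⟩ := strict_eq_true h
      exact rootOk_makerWins hl hne h hf
    | cons row' rows =>
      rw [certifies_cons_cons, hu] at h
      obtain ⟨hne, h⟩ := strict_eq_true h
      cases hx : subsetBits (Nat.shiftLeft 1 (Nat.mod row 64)) allEdges with
      | false =>
        simp only [hx] at h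
        cases h
      | true =>
        rw [hx, cond_true] at h
        have hx' : allEdges.testBit (Nat.mod row 64) = true :=
          subsetBits_iff hx (by rw [testBit_shiftLeft_one]; simp)
        have hx50 : Nat.mod row 64 < 50 := by
          by_contra hge
          rw [testBit_allEdges_of_le (by omega)] at hx'
          cases hx'
        obtain ⟨-, h⟩ := strict_eq_true h
        refine ih (fun k => ?_) h
        have hpush := slot_push (D := D) (k := k) (newSlot_lt (a := union l) hx50)
        rw [hpush]
        split_ifs
        · exact Or.inr (newSlot_winning hl hne hx')
        · exact hD _

/-- All edges except `01`, which is useless for Maker, and `23`. -/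
def rootBoard : ℕ := 565234498108348

/-- The table whose only pattern is a path through all vertices, owned by Maker. -/
def startTable : ℕ := 716519850796833003356972747280120797878290500

/-- The certificate. Every row consists of a digit in base 64, the move of Maker, and of digits in base
`2 ^ 32`, the patterns with which he goes on: each has a distance in the table and a permutation. -/
def rows : List ℕ := [
  15386526,
  12463345,
  13531817,
  32597865,
  491924526040558286,
  646062587220450459,
  760401626106002737,
  674070721851999701,
  1141566573416753357,
  1197365139271968029,
  1349856132032229156,
  1494602439869748445,
  1714392615290064067,
  1782832816088569055,
  1511477194578876045,
  2051294522997320113,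
  1917941079819019541,
  2440481232157361822,
  2502440911491124964,
  2664377533779924265,
  2792008568654456987,
  2512509964134561951,
  3069754276973245729,
  3095986150477522197,
  3083381074335259853,
  3287404802765436190,
  3743030601630792864,
  3527981520406599317,
  3959203383758531488,
  4094188502177794793,
  4321985046408570645,
  4359138643904771424,
  4592447864528676644,
  4313949815502190750,
  4677910979247297813,
  5042560986942401173,
  5024812670261786788,
  5253954192139743025,
  5364820148625860273,
  5474873840848753886,
  5539082845994768013,
  5824640584391149489,
  5905156721398465758,
  6051367303723767454,
  6184486001194923856,
  6264195921340970267,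
  6529996535196903264,
  6691850419222739625,
  6751868635898377441,
  6842769385329706376,
  7132056117329653417,
  7276063553320038185,
  7275114949657937302,
  7538294877553895201,
  7780749561021458581,
  7825416946118685972,
  7996518272742442660,
  7993374219175937672,
  8334455370574195505,
  8490334783332372168,
  8537328460177335985,
  8761040043702071053,
  152771763983278400887998269856211193009,
  156819468692195159612709253716112987789,
  8466321449638029984,
  8556635334709996168,
  8635556355213281249,
  4033631526199618190,
  5664935971523028621,
  8410884623222041224,
  9406312357224498852,
  9004724256427984548,
  9637252954909174408,
  8563019649289647969,
  3951812743058544773,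
  9694542733543982756,
  7986422282689341069,
  8997585677384017245,
  6985622335033943811,
  9622916148194094897,
  10302642207983905486,
  9510008673551903374,
  9428189890167359457,
  10127319306593808177,
  9562239874060955441,
  9555218667690383493,
  9634172398703441121,
  9570565651058014864,
  5538957778252035937,
  9712641245066156173,
  9856894971640662675,
  10203933277058644624,
  9868909335359088481,
  10012041285197489437,
  10148150104508954465,
  11239514076234246792,
  10154153438063752545,
  6699762506609584782,
  9419690940793800341,
  13472279694504750884,
  11015334925508164240,
  13541985982973922993,
  11939930746077816612,
  13019876839344746289,
  11452308059393281713,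
  11163080976055912100,
  11198991575537077937,
  11433301351811761828,
  9195126961098078864,
  14113811469470103393,
  12450991447515690849,
  11595022469957332785,
  11705888426442796849,
  13540995048526292739,
  9282951002352875361,
  15048064575653496475,
  12237960794976384789,
  14392280656487509796,
  14459350865862635313,
  15391468170535153457,
  15473779535169367857,
  12680650564652616339,
  10210633152214824161,
  12739064044185024353,
  12816774777212921485,
  12874083797263101745,
  9547254631495282481,
  16353509783878151456,
  10871219738323084941,
  14257926658187974789,
  13471019380363159192,
  13901885276850924832,
  14039893227651823457,
  11455404010273418528,
  15920763997685437661,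
  15554963351072029328,
  17793376335871782705,
  18914918878191676064,
  17650515690587810446,
  14698278591510849283,
  12966772078189603470,
  13303260294625871521,
  14896068089131919133,
  16553392751954052766,
  14914033834316625761,
  15418854532111788680,
  20459515012124954289,
  280421770919150575362156185486232372449,
  15904874405865695969,
  15977547726395666212,
  18365334588435085983,
  16275539291939432077,
  15545202162240218765,
  18476685429713762068,
  13894637022122440545,
  16641709374627244686,
  14049760245739923203,
  21039346867519743263,
  16257777506510067342,
  20353290369632950740,
  14478727010932404017,
  21251759869726207264,
  14447171027282341681,
  16986373284803008159,
  19359267261989496612,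
  20877464121483093645,
  17073529647560305952,
  16635952332095248031,
  15560476028654709408,
  20462866874100471972,
  17507229810258802337,
  23838633103546107553,
  19732458551155258596,
  19794418230433066801,
  19928198833876189024,
  21397510581817038981,
  16496339644531257137,
  18703419846471931552,
  24353994269821335374,
  18011942756246512859,
  22688774838637544787,
  24783124587273142155,
  25651032886752212168,
  21238523674661702299,
  17058411638190483236,
  17140353566869734622,
  25709588752815279281,
  26286049505152257201,
  12536550772038092437,
  16343979494078511849,
  26718395069581151409,
  17361915880357882528,
  6619944837567136990,
  8357210318006044309,
  23841709811776275653,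
  26948069579640456841,
  19013851012224959710,
  18365209520665154781,
  12744717185740330205,
  14474099442684155101,
  18733503859769656981,
  19165849424030779029,
  19742310176367756949,
  28453274610155804301,
  18941670273203459293,
  19220139460032964388,
  17644633580587865309,
  19309964612307961493,
  19229900649489388765,
  19814367770623788692,
  19668159112441714336,
  21381338141402846889,
  15627020947727209693,
  19662246213884728541,
  20030540552922121877,
  22022009823166121621,
  19806361402061247709,
  20244219642747415200,
  20820680395084393120,
  21975972446727722637,
  24994508171382801605,
  28885618250336879838,
  21814212845968795428,
  20390705378027525773,
  20390828523363419784,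
  21685371523774409376,
  22840663575417738893,
  20661291341529720612,
  22390673598473545508,
  20964795583529347744,
  22534788786616510244,
  31775805236020168323,
  24137700268301768333,
  21397141147891133088,
  21381867282143880996,
  23126923627101116064,
  21523675419932280478,
  22048153186755856021,
  25244340305102874404,
  22192268374898820757,
  21829886934586185376,
  22534788786985608996,
  22963763248528076059,
  22982808439293695648,
  33401922185845241713,
  25288651448574498464,
  32455858675531042289,
  22616732639944427166,
  34153828985110972063,
  145760586325432918997068334749,
  22480498751419631253,
  33641419457343411404,
  22694177841211370144,
  22408318012096140941,
  33209073893350724816,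
  23126923627772204704,
  17140353569252099294,
  35275419631268494065,
  35347477225341445425,
  25643149665828259038,
  23270638593783229088,
  27305863859940747936,
  25210804101701354718,
  23273009140886820493,
  27018033706122303136,
  25864711979316406944,
  23849469893290907277,
  23769652221110568158,
  24187495501875855140,
  25643149666163803358,
  24922573725818078430,
  25288651449446913696,
  24107677829762624864,
  23769652221311894750,
  23687710292699752228,
  19670129439393076877,
  24273932234426045661,
  24687509684952475497,
  24568075509302515360,
  28882664689843295913,
  24418047422636119261,
  24706248936641149609,
  24562162610779083997,
  24562162610812638429,
  25715084115453039837,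
  24984746985751553828,
  24984746985785108260,
  24994508175174423773,
  26443666424696850056,
  38251227511319872715,
  26443543279461619341,
  24930456950084912789,
  31767893152727186089,
  25144136039876651680,
  26287927474835782377,
  25288651450252220064,
  25288651450285774496,
  26585688143002031776,
  27162148895339009696,
  25651032890631964309,
  26137668490861717284,
  27450379271591384736,
  26282493688638483697,
  32344353905399708329,
  26219612343753426590,
  26714129243332912932,
  27569813447442671465,
  25144136040346413728,
  27161748673441950368,
  26291544868595324125,
  30899613493800041193,
  27288282945483097758,
  26868005620999410909,
  27722935560132339492,
  27444466373369943261,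
  27434705184047736612,
  27163255279485142229,
  28597359015897217705,
  27290589996072544036,
  27449979049962760864,
  27524530336423397013,
  36235463984051796649,
  36956039924464630441,
  29012000518889174689,
  27883831220132857045,
  28389221465046304405,
  30605949331719466225,
  28172061596385232085,
  30909143786317895328,
  28315070400986044064,
  29467991905626445472,
  32200238718263376553,
  28604407160780571861,
  30614971649496070825,
  29019972253519685412,
  30044052435865037472,
  33649302684797916813,
  30308002021924120425,
  32340765375498124009,
  43736119002814343323,
  29469962230732314253,
  29452317817982134052,
  47769220013513165974,
  29323476495754193568,
  31899968965017781918,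
  30240333403645493028,
  42864901173234550431,
  30326741273814121129,
  38108961429943892649,
  29453027827884371185,
  29453027827917925617,
  26875888845736007309,
  29740548194502944548,
  29894424571968115933,
  38980140776717371313,
  35522800130421577357,
  31407757192117273822,
  37250212062628632224,
  31485604539627951776,
  49790044045632005344,
  30028778570923091748,
  790838258015171859500133204395625493796,
  40708576354384341664,
  38685422182750632617,
  30188567847146575520,
  27588552700976839337,
  30756162137748657833,
  35208953607627372193,
  42279279567273078001,
  50485040397909185761,
  32927862804331316437,
  34513855275995879571,
  37676615866521631401,
  31187843872065682153,
  34217880214948435165,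
  41359588393551054485,
  31323508213788100254,
  52507438380922534641,
  31695989493118977694,
  31469930452319184676,
  43873568954051869353,
  31469930452386293540,
  31912037206003176669,
  138259899363806462267365386417,
  31992101168922412693,
  31919056488303641813,
  32197314019178305193,
  32128333133536740574,
  43143260686765500196,
  35811030507714139789,
  42122076343204031840,
  52301334651337943760,
  33070471387370613408,
  36961581465452276384,
  32783747617060766933,
  32783747617094321365,
  32834406790722174756,
  32783747617161430229,
  33497275413194226345,
  33216957122684278413,
  34078427231892202779,
  53376439594927469851,
  55986997133632034464,
  35667038465410385544,
  33341120847789606558,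
  35087233548590966043,
  33497304275642897629,
  33631658274396546852,
  53671585349665015460,
  34145947691448714910,
  56562370744048543899,
  33937656208835659412,
  40350782078261577365,
  34801360250760283349,
  44940082589698047780,
  34367508080825068192,
  38887244690579210020,
  34494042352832661150,
  34632492857035224737,
  49274915703632873449,
  48893873901753058980,
  47745743519091443689,
  46457294287092705928,
  51806569539152103076,
  59147450674924146401,
  35482400777092939547,
  44817121455992072840,
  53609256234579023504,
  44727912030383762056,
  57492483089500711109,
  60488263873716152992,
  36242512132135700129,
  36242512132169254561,
  54466189209188091553,
  48610680938587408361,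
  259535776923360414692127226537,
  41401567749525352177,
  41413262704941066888,
  41473557998458728177,
  42656625088313551496,
  41706105257544239763,
  37251301131710875300,
  59876265805519235269,
  37396405330466425491,
  19503751895316119332,
  18941641419042732713,
  39554804380318229787,
  668512226467905943432874775589625449649,
  33423030067570394788,
  20819695240433756832,
  1996067442897122977,
  157463564410018028667685808353,
  38510697693456755360,
  35712952698356520158,
  4808620660802430756,
  5096851036987696932,
  36802192413709543204,
  31918531199069038372,
  5250727414519977181,
  3527258056300910240,
  1056226869228642034239110585950041458324,
  33178435734952077984,
  33414869767637616277,
  5827188166991172829,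
  5833101065682376352,
  29371884423423379093,
  33335052095524328669,
  29515999611566343829,
  6259533731386512605,
  28074847730873029854,
  27523337919308203241618982321,
  6384880805828339561,
  27533535878377245920974026020,
  947403136887201429118747639470559278372,
  6835994483891262685,
  6763936889903666398,
  28999095281255574176,
  39087158446599039648,
  36087756421879518880,
  36217355857477653725,
  28309128645214878377,
  7492519199281694357,
  50142608500585288929,
  8426774229452712608,
  22972433455654872937,
  20724973139541251294,
  27162729993538873124,
  8140914400438146701,
  26287923633056863904,
  8282934194329543896,
  8281808569333900571,
  8133031177144390877,
  365470995113602035635890907351702780558,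
  42198505599003650720,
  21937451066142616224,
  38105369055511926432,
  8427174452121523872,
  29371884424497120917,
  28858866867522103968,
  8571289640298043040,
  19642367877919664800,
  8781674593185089182,
  8841538878182442654,
  17770611784573408477,
  18589105832509455017,
  40528310328297122464,
  29900918567651223332,
  18346937846836640425,
  18505703477631735456,
  60022351321084865760,
  26849258679427843742,
  14902823775836001952,
  14735578436557990560,
  14227288504655304333,
  10294730136873745065,
  51519426307776923552,
  10573228185917040420,
  10570921135596029598,
  17923699262914516640,
  14534150380399785633,
  3824897548073288508970874480087841874881529402573,
  3836315529620398519850792316047975765102607095437,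
  3840359499715007220060756099563899282428003331355,
  15692212018630921524860807110909275179298053772237931697805,
  15713248662747324741205350279451370959910840344231707801764,
  25568411746290988897,
  49644803237818845169,
  278839677747054108160063882900,
  11428912390395897705,
  793039725903500039254286153314486605021,
  197696582647402236484280116465,
  11743917249113278088,
  12562203764244530398,
  19623847979995022558,
  12820438363745993950,
  285613960866655601620961613021,
  23777133307252098270,
  4214202885159929799196909130298738574802374835748055176845,
  4007585252784990545300958251975884600300327818893,
  930284778105859558184061964778553103565,
  931371758072092367102244934315244760347,
  219879019633390873725249760539,
  3778601201041284355160646031396788293697529337485,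
  790347834456825048101865145690366375133,
  4053257178964728121808586925311542732919443969677,
  13061790520048725654126867099028478809912491585878369727709,
  777425830228792078865649925037775307997,
  954210882034320834029505867183739000013,
  4133183049777674942876109026607723340917156501133,
  806480336294265704720691182237623154337,
  3863436023391909879908647108846340597883040331425,
  948893970038148941944500544498428434061,
  289873821115750928022042485149800261361676758342959234187411732101154111145181,
  320671979056194328801812506348911001975534599786194944574229579837612152449179,
  12504621293161735455823782918438850559301446323112003655309,
  566161812743646862035680834741846592661,
  12574697794597265097180099326890411323311222927552836663460,
  16626066086478718756,
  4746324259626702046,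
  290514152789574261149369871601,
  633517139400151880597410238892415874273,
  9292446674649327396,
  8042836591449625822,
  1239772281469198061146152818994725512433,
  56779913523839813261,
  977956923804251844204931024928101869348,
  974278820369145843459219391451120486043,
  301398330936349714731293959027706246427,
  214331966224592081793411837801,
  981944607718258644494549780437310732516,
  4361542680653018399891916907706793242832592852621,
  989913764279956392464038361477317904036,
  934171090571271639041378877714656317153,
  938407837519176852957796494051320186517,
  865259372902617014882763737081098491552,
  1004721013474788384648565641475841211049,
  870611992069101847179735874647738694304,
  1010167976269574882504408040376995628699,
  1008547624707542299544526900240978405531,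
  1015477789410589555122679108526390241435,
  1013860312880121595443619341323032020635,
  236671959096562932258004518564,
  237323589002937348115895396132,
  1050060717519759397882510801092650620557,
  920934181652312932268893741296459163428,
  264295551730231700913592305736385657060,
  881105613924774317731513412961884329181,
  297701770363594979385026514030570194587,
  241006195459805299928781388004,
  927626357604792712711397912488825476749,
  979468485572006599941364612883137058013,
  4592697135009776744664516716177795242428428954011,
  335792110419545938287731042181205584544,
  286758365903869057370856654082378802980,
  910312319243908814100303555977109030564,
  376126222283815065327520689550177814171,
  321318293734236778163032306950189328164,
  1045886759877300097952618674178819258017,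
  3813479565832612324005804466730248423279181846157,
  233621008116960033412751447261,
  963481439046832828096895306190800012964,
  965993871831046140983771181456603981604,
  175413166063832855036977401569,
  1018911657120604260454480493282505473897,
  183827250841763006261485000333,
  3377564003557752567069543040128703059405502016160,
  893841805945079880956934320734029720928,
  1085618179997824800988903529454924973732,
  939588841709799598863988121333093223081,
  639290613598759008170105311532820915416,
  1037951713363840022383277687442830670505,
  1067015199541369976971171848840239479012,
  1069524331363490400259715868345991648928,
  1101593584434150361340316183844083414299,
  652582893552890107270869509462792791256,
  3440602090611925173787635224318193218733688438564,
  186911919476411786088178201952,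
  3464606556126222112789533606145832514039442228445,
  1027320693354652749299629183171114718429,
  1154924309382026066070243930652536653021,
  1064539077328856397749824401347450946781,
  935601690088965363494927706651914557069,
  3533582913039885414297253776932689181390030169312,
  175437173395742646783069506217,
  687122057336364867371753142752353052827,
  917953722070712222564656274971941106909,
  159364100850541662309272446235,
  77047298547579862437141942605629838852315893471965252686938160655365487644125,
  120348965608723678361993237729,
  346307409882756687900209497748,
  1084440583288499519264196634715055084749,
  26083378465930659469,
  285613969109819429993699759757,
  28008858896666904222,
  269546136065883933915185632928,
  270101100310762249280162317979,
  270163387142397565752935836320,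
  1097769777056666874255439982942635316446,
  271335726427845551405265561380,
  487654127036884785036258209781874869469,
  261345184704026861791419018592,
  260855688987867574968229217501,
  274461790191154473960528914212,
  275121626389116561346333722267,
  262093629025711803362067793117,
  276287486588157606645450123044,
  276353087340193561414504409760,
  229804629998214878584141201257,
  681220697643354460517819524982349155477,
  1197602079107679974658572546016047676073,
  279457432940000715070324488873,
  446591207348608698922677460446239151309,
  248433835703083628954272495844,
  244132259228806772420807206692,
  206718960131855353063734719840,
  281925536460034773356468167904,
  282511185462799152406616065700,
  239715092206065336600197311840,
  265806920242413096006328435933,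
  288433713050859403718868780680,
  537897271114988193747218878475300192036,
  120650525327965063722042902180,
  277905338650392199265723036955,
  263629814848639643155837986596,
  223126491899474126562994873627,
  288665440747701825305757337252,
  278524308665119575990471092379,
  1036770709184977706845685486750178920085,
  362703891500770497715546712927268387497,
  265830597010375111937788865184,
  217527258697745243923569099997,
  1031448579596222645557632233723181778281,
  1258705784021251676746829007521313843872,
  222088925415786655557352520425,
  119139528604748964998671624347,
  237359695050900941599099774176,
  1297297124832898185160335296743217976973,
  210656830565495107989342469924,
  222479018860074911796211635421,
  231143946265744437161253288617,
  221880072851314843198533527707,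
  213718351389142801354629295008,
  300412838556958126868748806555,
  203933595049876373318597031264,
  195277601152609245214224799891,
  218171087254559424555620132504,
  241004757502590370743458363041,
  225593892969603329590310135067,
  237024814320885496489996895454,
  987566557023910585543875275731997451928,
  854625548932623330614723373696132998808,
  249071127312555892738148191969,
  1103086689119034700305130565950414673118,
  184750350676727421643455915291,
  196196469805783898478724901536,
  5519843386550483020558680990466939340035649590924,
  256170960948761370863720965924,
  199600804888742651509448239776,
  302318226072125859193284970148,
  200807142851805540562981340836,
  1274557100626972844536411533116729902301,
  304141137453984939225279866660,
  1338011562293159811496719886248762768105,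
  277567879504096920243873404125,
  316286835012008087223659026061,
  204486964311039435081135138596,
  138951238487675047310213921449,
  309092897636995136585666897700,
  280662729616001313799233492189,
  281281699644146923179199059165,
  240449173442611185782961334427,
  1152263049365896448295186239198680959657,
  225602966989449440471272547992,
  234887517284090779619445368024,
  263292240011715381486998666417,
  207024792386951924118749309083,
  1412356329013024679554655059437547110249,
  1202733107894072929027677698632831072420,
  1141032212729739344448893536012639821745,
  234858948172530306795020666077,
  1372695081055701879908129241379571463389,
  262626387527290846546696041693,
  1333043132455126483383956331761713988829,
  239535081506012171967158470293,
  1394287039561193061986375164110681795232,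
  320199970901085047633852099232,
  325189432047072168500002244251,
  655259558154438139270376874917370193112,
  300353716895197804300944198805,
  308491720298684564826334351073,
  1069996581926463387576277875973482829075,
  275709787676703477731541531305,
  244723139424164059620824726705,
  899819300800451930657829875327257962136,
  239840335258818684196184606357,
  1462121396241522081234336170572133324429,
  226221341996102310181005616411,
  604730685787579358001696917302122046680,
  1384883024401258738021598465016274273928,
  321514750907951415186023142621,
  1064539077302859656926848905063973176541,
  990247729346428237243248282484472465053,
  1234576617691082118626642658527516712673,
  1010959289514724753601829618208788949920,
  929077969664754503748507300581898315931,
  222507521882427483983769953563,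
  1339772506453876514194459108025063884181,
  1099219153141944405019711345644473869595,
  218793701769615374740754457883,
  340725969377940526766501259936,
  1946382254426113744379756443509061572820273646742,
  322674264243267964391135037076,
  341902606039211627787218531611,
  1473773199370946945888764873540799776411,
  343140546078769841429387621659,
  343140546077616919924814329115,
  344439789518831817453342943904,
  345063585797188519493897676955,
  340041398627927937433491711780,
  1386163980258087346729993196402491762468,
  314734054824248351616776136859,
  330698329945520289309023399785,
  342792376622438750892035356000,
  240352838373735260958699416224,
  297985435963089777879307241124,
  1484674543256617210789039894596108282528,
  1502854290825783888117125090462032587424,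
  336060546378850063048809272542,
  331278086605824809276032049073,
  343101861633196844677951599968,
  347804911260922424624273259241,
  327414345522660741002372732309,
  319381685143656261550008325773,
  354862291979481697352946936480,
  313372524559254018453943594336,
  329904704376791410169522078917,
  317157829483051640649006341857,
  1569588073249620633514804532140824045392,
  353383252729325110907473741476,
  297374399514392236021318833804,
  296755421230456325594513560797,
  1268054108936805354488031261675696838285,
  290589397812655964065009448288,
  1119035153641600248236131239308719445645,
  291829056794349826699754165920,
  356100232049152102081791912608,
  316561808987820775991043570345,
  331716517016606107776912292068,
  294303217932097371961818213024,
  333194043953178750279459371753,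
  1409582268410553211038080999514065317216,
  1362240467409960634367122359907983685796,
  316830022878709710822393489188,
  3425268193929673242885704564811586828454315578573,
  5891552206856452061382345358600798035044048983693,
  1444818432131749879687287430013311641755,
  360775448049117650844110014116,
  300083445251047568166543635808,
  1382367716584830609892693207513550444173,
  1596350423546248741204134644576042300699,
  633869206784913277821179017533738370269,
  846542882115684946408513315373013940905,
  5155023949469211668091832558321281205271283811997,
  368893171242973115391713560497,
  1333163280345620236940383169859535430939,
  1287667046812543207308817766244322474212,
  355533970723092168136171638497,
  301355772385048384004647790372,
  244681331146997098477775846121,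
  325836301833171085615234262820,
  893032355432985957103781825931252319908,
  331131934091397890325572695392,
  263970034208202705197019293851,
  298526648668448253264782390493,
  1486047500213345116653956731739198871181,
  377221399826209048625334336169,
  1282652616651242909377194806610429864091,
  257790465846759327072016352917,
  3949724575564002336764858795507043943923509261540,
  367937502388358811756787582173,
  372613106841582407875894858957,
  276290536056451477418719194353,
  375353903412015496293332526884,
  1636206534961269644027730351192091519648,
  1605534871681094904103463202598953047262,
  382440844974605133352422176996,
  388286292924897888510599423200,
  199605631172363336545331439771,
  297402894268270273292664170651,
  201704913168563623549525189851,
  296136451226522067811962897629,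
  1468581262728165081609503800599390877345,
  225256458672223394117709362404,
  317453290237873639650674206875,
  1254616409219708277535024405837738825357,
  383953882939053938574731720032,
  356739110366620901882620521755,
  1507945140190210690378642811150572694432,
  1446172932051377820945614349699596863112,
  326114573185239565902309325028,
  311610701721048208907895198941,
  207967081593136055669724435661,
  346265097501776849666380908196,
  220521666460938890268912512873,
  362977288021104671482701313252,
  6433651134915548463444224706646090780809746113819,
  315262763909465208002366357284,
  922454830064879810401526058086500554381,
  369445788492092938770865145499,
  1610849547563856535476574091436038444685,
  1509481973864542382797164321020394437353,
  339492855616511224002605607067,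
  393299207722026029886097947369,
  1600049859179657054547110585348681844379,
  321204737023420112665308714637,
  338832490550750183430070446800,
  331441419098697219598915332768,
  404066111227486928933041044201,
  281924999307156994172768380568,
  277543748255751315790781664993,
  1605532600084058035438473841563781453453,
  1545673930748398042377764910720699988132,
  401694516333763042533571507552,
  345378425982924657312738756245,
  290590579576534163762305197720,
  355457130745927274560607698793,
  1005612562265700634573287518252143689577,
  1566883616715920279374741948836050816737,
  357274827444940960340783058865,
  411832012211518146325509534941,
  412493302899142662242394863265,
  218755686742181741450149656225,
  356752151189896714886650951329,
  425501185333869802396013450444,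
  4896397723533206157246649647136228843878964765742415254317913564728544957150573919295033293915809,
  303551199388618631559686018273,
  5964699370281623470206161083763726717520717727721,
  287432260895977725800857683611,
  368823504541954279680195143460,
  913106504916797117523854281981296588128,
  414902383929858636962866522784,
  1036752536191462900149815045646934558363,
  421749738584632473551389013275,
  423053808288308377881165555867,
  854648300788117496175384443479949526683,
  167036633626483252729820923080,
  1686435445755063440775155490063734515492,
  1830273822227853584899017335987198093984,
  318453230130845413788761347276,
  298841207871425035436377078505,
  1697378850233048978331675048137524201115,
  7957582293002513358024611817872911541296093091469,
  242853196843723595551006487773,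
  254071885609980786372117456096,
  6947090926610560557740050538650146873459202770141,
  322657074871332308272798477664,
  163935048253053657745850623189,
  1754226073546593335492299404673302231268,
  206643979595861255865727444181,
  301663811203064333993267152548,
  364213641358069808562420741793,
  245405768150255888699594532504,
  361767297327744532793154004251,
  6353990216580346669437913595566600018933856257677,
  3727072715834019466744664712313990773667507075236,
  370412729621668795306135636649,
  361767297315494741809457718555,
  340073215586798280015185836196,
  322742650038991031705804633761,
  1035423024315600965506010189707135633045,
  266383966274587872893278594852,
  350553980271351512251155838173,
  366064526854922266953584311017,
  370680414613932042104468121380,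
  410297809756661031281630856859,
  417444468035649363734177380516,
  1173635192461852786326363012421043481248,
  6513841958200632559989134718293627332468361840269,
  5307898345439476800984934300636858925202355472027,
  273577903702058751990177617549,
  372245632351713492921750310625,
  317799749049299772086469671593,
  424838258344817437363427211428,
  393005788212062281598045701342,
  408789523716914047774374151389,
  1928664521408257496403255749192550139547,
  321781783061431677809063196900,
  1537864391869181437846642233202070382747,
  366423935551642739787288987285,
  323394808865054863853296235872,
  352462070147561037533345102505,
  1933811061255946637317249295138657040033,
  1101711780311597615787896305830398916772,
  415468719601109543915847920992,
  74448753441134782709821344444879052368164875676286505521775679879332,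
  3521671767591778620000787056309390198485416757097,
  445957285706304405943017224342,
  125923811379442477220,
  230442822458133954337388873380,
  5359279262006036746060399282723651213663051605211,
  401350644223166156512509130980,
  327627611131825355298840898208,
  459468225352107439566462511776,
  1270533106095431315503394406030403684004,
  268272693297293469781870377124,
  96208482033213488761214483113,
  120615080455207820845767112164,
  288207493381429051751431271347532756196,
  5279353390914097465423330033795327735539154445531,
  32831642152533373663162255988309079736662545038444498671244,
  5376406234742531995116963416479008707047107020443,
  1283825386230615384821368273009003623652,
  1971070334386011810817697020551504746124,
  424206842523815027942003551515,
  280033123648887304179011942564,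
  270095753395233802221662894244,
  270714723415020607547220031652,
  1546718814691847369250576863985805683360,
  5000322787136559534998328573848658458103214912873,
  12896885808117670447251115763930270725390951079160307399337,
  5020871442932929021054351272074710057939750595867,
  12979695379501115509592146348577181373686729970297728585441,
  6737885562910132337026564488703521423823311376952616210145,
  4400694600689323141696194194900519868451071178916,
  5057177165014947374870373540821105470563079662288,
  2422636555603507633826945598685539252097593822945,
  4139842336587368022331769086219936357479744345264346347684,
  243500397146044507705324494561,
  90093980179447450424465242100229606486186877059492878353250668955029,
  404246926867940186386355239582393910882017943210537237783109591512525720990984,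
  323685200418736510446016942187364492402227001886806002238245591730002826086049,
  18187247208014646697765415903917200407819260473268986689700,
  60329636973290012270518243860862551023230383338273192959614377605481,
  1381022587112995200747866766085908751579,
  1378236884564353391120714365079383885021,
  1572121838059099222496937991594915374884,
  465115795469522974762290037981,
  1100203341816850125692111177866661819614,
  148188608823506394701050311908,
  1937839066346201542103379808893906442409,
  8933817429010454116707977804580723137751516330665,
  118092433728864273041128759805970204324,
  282916705017717470299569342853936563876,
  942213791213309377282848475242133178020,
  946201474953076117068406962663909213860,
  291055630445942944631109332381445080731,
  1282343923355348368160279801745536349412,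
  296208985433604443529392634794243245732,
  5240658962622028639364156257157999289617751106779,
  178802799320342958111037777120,
  335626413294359673565920310555,
  74860491943473834283796171691369761858857202742979031201029192926881,
  874355830787566664515289233716576702177,
  21542049338856097205544216992144527879663789099143153036640,
  9096393113658018891003348711232155520359401134775984899270,
  1034610739100972072687985520076218062817,
  4049619652499153697447263458232104390415476976100,
  4047389643845580036350821977459645727767520994638,
  1270034057464581484107961824482276912411,
  14588760885833055777545548298219362057656131243552553159337,
  17800627317254932795331850447697387773688418203370022975625,
  4146583467071410093299436345727410046384334826473,
  18839659761370609541015417905101184502777103563894855253796,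
  10924705472646418771884172196612874379612316532500607922025,
  14823374130025040468811246524826640916234409158705203506153,
  2119891743121888580204904048102152200940491586537,
  5440199321049060901654291010263776497897225807089205429445,
  2717194793855484037637903725028029151397184486030,
  423305338474233761033859527428614725594296753335862469132738912241653733311685,
  1210853576151641826370494338763936971406,
  16842008047605527817826716986635895229692809731998142350982,
  5381073406098633430857430296257023328083864955808,
  470129643623306988381312323911324511515,
  414442944335600463707515966901323484897,
  4106788832650359335226096687853405647318666628833,
  23310758620999785476490682159837564050653399309850113977627,
  4617377547897232311120887226229168682984387796705,
  431446969771690815587494457980556014096804428626926609909946136565837006292165,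
  12626115714656406374225544459190357573807480397956660513942,
  4057301149374509276901998722885802427811066522011,
  3998238736063751064650247256480479955834230226724,
  521657967187197793983626910818657873248,
  23268189032158744937801419169006440575250070431655039808846,
  64620466869757199674617307729189058180548679642667183992305115673933,
  5014439093568577830494558477449888314919488973284,
  1289776513827605452320782930569449389033,
  455754054237788670678292142852357286947709307551005487714446253259497595155789,
  440307961418152511716881947759796435921508794820200353910999551730783236893077,
  21744039998068169355515493852522908382913132149420026648545,
  3813323308807715285358073354630506314046754739425,
  4110356843184006393834714113548569505871800747206,
  65766840803250664411615914108727858879720255553879147590684260149652,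
  513015693335272892628192681878290119310,
  5074529910524088287830923715561463862117510296937,
  1639516406470779299081554138716450647549559082119008399328512347189665693083884263265505,
  22287401707346347623412220610523986496293397657986079901345,
  102361398231275262258358951744100700654803740523464637542669854885534,
  3852007065380254599221790217117766738403202152612,
  4937514132036422197336010608906370718265972999529,
  19490108616389813567436161565401910555208725554996589771433,
  1208238174705382335679366181076116059497,
  8646626694335470777766607805374553458449523655251852949915583495605806294936590753466429304625117,
  470284602739402747002588054401194142170152980970725444972261748843913414653192,
  3919911114058397770241063502018737603631174079713,
  1165702878848002152992634498883652273513,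
  1136459862817283309988525494335130187113,
  13411804308677632275235634756253773783298255162002749930153,
  4021074699143494998291244972647923054050375317988,
  5243384271204637603223324978589615937111471402336,
  4405874297503123442662566554608330347791706344625,
  1843874854171210512238296354886439778649068419753,
  307837834279545677314658904475,
  949888629387885760102521639530139694414,
  4335069191605260756974996131513233250669303670564,
  69398237561242142374567764696178226779532096497897893681314226125481,
  1300730992542019880387086685136550341984,
  4032374382350593122412542691443130566991262990185,
  466946481673652601446392516945869056741469674933336022837448102730875476064733,
  4224514248685641136054613061070116567021824916137,
  4352166893794428316177402667634639910311210465757,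
  23456270777662096922398816020752209400255746587554544309473,
  3190427583720839515827714856365585348328485796004,
  5194283344416613203141500555982995357680763648164,
  19638773407091195586842991542495281860451975981941348289686,
  5217645857717853553945005324894335223044001191204,
  108352680332595187973800698483139745592389727141574424518521213863583,
  466273199087846875935214695968686989518498863979863606173290344441305888540521,
  70855357152392600085984276699297360193079078021135910935606958336804,
  2722807133616831484179213337368584668761432766628,
  96990471366158456699209214271538180128459450761042503008594312218269,
  1308787642313260050611874437562214077665,
  61959510048864043366668014125530772125092833607558441180947911986653,
  24739628320320374251038495323574321523310726419215867038897,
  5562502207354553686152202322339651367579394195236,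
  97198033528289763020962979861929939718385817531802876425456315487457,
  5189343445948271963475958763582478603731188202153,
  24396774251190023604451198977087095622375333772744468346217,
  96779613369182854677989534685494002752145914867701172382494785157801,
  1874369819907602386067269291322736965143073072458035813833385298113147599872237248166052,
  23219775769968135131866501897665759260567910011804103357801,
  20816205986608535267651335814071028103329218090631175558369,
  4696609330120627139950273019702763449280824557348,
  4423704962453587844954792357090723195517581277865,
  686627658459334842931972401119139965856,
  5597966272534938817461313656486826081330595343712,
  22484268924157303835396308805621682410470235364858795837085,
  76126894111180796874653735285441194740951687582753228743775362860393,
  1119871118444485797455269554531768132900,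
  22922898629002694875461875311486718722627396979801305265513,
  4681254700626596673844709967338104997585677367454,
  85721822750117012140699588572857588099136322762870829714976093648233,
  5814582448293239898237515647971608689889285985572,
  484365713010957548967648316053715728959093840519131212229570533558108313958761,
  515781389189432068882804952007063515239798748900778322924826491923476310866397,
  492559461134646828840540900666799622637698173936009106467991395874993432344733,
  120509499682814111450783006013681171660075633317348245158596957620189,
  4709788220873553862374844512155365812640382073513,
  433757788317628083222939575934214531753726401124832858778505080234823298988713,
  3527403168027551632304529814522727404060349678953,
  2402731986316008135694372905216810581049296434537,
  450205398698806766889847062606447256058061272629287609518056323229498058917854,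
  6044922968808582117962702664160979386923289655460,
  24931630721527800429662242570424848581867665265375424727009,
  20228435487717264677487197085537526788809343626291216828061,
  100558932393964528030760769144204396836939315601265857540761803638633,
  24663865290975848892319452518092313792021610280474646594757,
  110666131193726567514494566522266741415634177367583063377523380540641,
  78560820319575722367952180338224391596971967100683644934659463890590,
  18487520552442898476570961588927779508838247031600903276190,
  3971428829833129557477372281222557870842817273414258009471774840257440201150214935629736571487902,
  103718714534668963287981819703823501013642762718793116022201380649641,
  7800047878449400056012072675460630631757668026564862447475777950722216769356078664352226142803169,
  401192265691550178809020625450262894908386688518592288495085207524132825777821,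
  2542554781985449671353860093862357744239102156555232191263020293737980690421292610784178560296625,
  1299775837997173566552155109781197420708,
  625724921752845722896465660007623310513,
  2500399035883692326042825425247907087055388031657,
  3862117361724703988720025036975213929432874465444,
  1346454850557715249070586919401312105905,
  1921764344121032709797486021792313540210427590305,
  962328723874794845838158716524711262889,
  3670742144455540546434062253770549574833429689705,
  310667759691055490906986402741231012978765122183706529579602112206797742258340,
  3693587863910013872381367788140559240302637466985,
  5919470301326924474511015472543333702258084398441,
  3201845565424807481212534962626219472279005254948,
  778897531965067236740905217152551339369,
  14585504798638729558097835735641254522812220456422896260321,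
  723046920416056417004313700150252258737,
  1259440058042373610611914956482895280292,
  3611635369826219351921465254137709356176534566561,
  1265209379299658355457887008436917327073,
  6089337364331864233398135818673013860792490423969,
  14879571087831865757774603131731291879987297094231611364644,
  1501976797745558708633607585319511012785,
  6638089688859646167425736669679889824741988877745,
  991553247199504459261346292123154396593,
  1101879171007112679923751080478673089969,
  1105866854933566547394684719260264971441,
  5507653415554243260611354490513796250138762499364,
  1404253998302175333376372700231201172384,
  81189983080144577168867770144239412003112094248660556585961398680206,
  441735867479184929725062633202794577769,
  4435660774787322857885848936299878244338380519561,
  486900049785966892943658188760959346532145582330944811243176071493026506582427,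
  24798002422316157829909691856660756684734975534690580511204,
  25917064173992784872463879864693588045222440741861026612870,
  92145925974746822113527191424983129102596521566034269107623194154182,
  666763066345118214404666778115645584718,
  6513762685366436027247002066875701247315799390345,
  6260843532013005232998368379211437508239779643172,
  1503080672960953777744366412366979160033,
  906441908220091766339631414373731161494,
  3899114428530132896874461482415318234630926784134,
  4424183034248077506651030768773972096858681719438,
  4241663630774569571617344907283432281709699843718,
  196381835696875451664332700649,
  1337114050399036307681386613808066120854,
  6365242183242353349316779579514635688685520537249,
  5257697973457655254002131754668854348906390603425,
  4446117581704774585501489476950876299810325581537,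
  1077263911344966243817256619848269802400,
  1159998973509335758782313451566767516955,
  72383784625719754419797843991375252139368687459792950139637837021033,
  24993653767319219466123015215210843970730569806244582473577,
  710276836483928687983333510985039923169,
  510357237161106905094444794972497721998,
  25410152082197011977686047221562759186321523093817741666781,
  3769790076910562007430186446821657281119944567773,
  3561214255881011545547845453470691649558318598113,
  3536444813242905030752075429265366252827461266336,
  1371554149937716768286996711124713297188,
  127516615283221597073180415655229789369643535423196359241952528939172,
  862459827429504075145640517589095372068,
  1204194019352507626387133891383676327204,
  2105854709492319851844852384472804359177244654249,
  28611522078615104973369890609218527183725949415815756266153,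
  2265571079263580346608493669336207939818721596708,
  1269136545724472534771494616689655045857,
  5403284795760738793658640415100108251870947945824,
  6821493129342871385075138889066082164229346841798,
  25717547170380144604438971326505715288465873403265458066724,
  4857164917772416662765720421798677099326873456353,
  1282428825502819858928722137181738158049,
  1449911553117041780777804096546575929057,
  873903386183784143434233097669435174240,
  3502815442824434894799051011846323149912121781600,
  1243281077511759994727542400423578779428,
  31378962275472416075991070879341585642101452412786044544779,
  1529911349725288839411781908108882623145,
  5787730413535587747707858522232422476847480753889,
  6787705214339483506556198026070031772764362455694,
  1733784664904263832517792632600812740321,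
  3047414843090863441824040050388931712185129420769,
  1542731130721614285010655201842173262478,
  1330140156964853230385249926232824327451,
  5576930855298148222007590669314395733695739315561,
  1727413179231031334233632152389344537952,
  1730071635116791150827446146012814486880,
  7015153672362354985656449590077659325542692444129,
  1004617902922431259014632242401853988577,
  1421390814111263861011677421358291828516,
  1640923310755734680724264701570298334358,
  1552262108797567495885227649609604161249,
  23530887988049715959346983842603138172380318407139900735268,
  1279463344558393555284321472616218996064,
  1454921440065759007026499383228793597280,
  1762277860513469025207631381259231059681,
  1342474691392362522662624417063340816521,
  1566719739889652867298273020415602016036,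
  5736782596280404674492611005199939256189177416361,
  370905059949343272317618727323,
  4623096296379241216268592826465691102412013225953,
  947299493900303235282105232192965394212,
  1352875637615191955101027542301278914529,
  893710299922982045166242674821338681057,
  627044069388383771650959847036306836812595877878271576301464999727107501321181,
  850475727338113861176023961712955849424,
  1595955940780425169447918176324451514852,
  1806003779345057479320420673616856197531,
  1449770676614587249821592467713434298779,
  1695677855810037885577332770230926028059,
  1097347750963855771867462101376928034144,
  1020568638809333748565284101501626273505,
  1473696780350548849612779393649938508187,
  1255260314782359377795685774489801117409,
  1875262240126095812376742499210753628129,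
  1332768797859175665407261922148023134692,
  7106942668637733363223054760698740856116863485574,
  19149563864935294390044895140365975528108033439364854731974,
  5794509120757668641145421996715446300207195509958,
  1540402699792002629392279457812212270278,
  88761691955224454819272792654943370521286839438351787606773077620900,
  23364257346912952162454246197690992696097768863478153069929,
  4075837946743253462590404341919150769514332272804,
  23366937247848025341745310496461172928240700534253355124073,
  7198898441244561869551446688988612146739275512489,
  19539148476072471928490628004547866277709908875049688483177,
  1030119351757622818472848095211971033769,
  1418256198144657772095556128567466015401,
  30404114868858636746926452557915944823900221722454044296553,
  5426745331963343972537033383727074302143044234592,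
  916750250197754171442014831974898564379,
  1590645843878771618367421389255071971812,
  1675296361377370396842151175241089075169,
  1856839925299635126802486552102125358230,
  410892045242021268821154150884,
  1323680893856113012520933476742238141136,
  1882632928684737840503969651821247178532,
  1437341550123717805625304813201183686436,
  6627853473023590827067782612869408407936608451214,
  6837451599852484485507402405498455628024242452964,
  980087119572570379870543195927559485924,
  1776301503905794343737743514333556980196,
  987527087473396211240833679417712467094,
  909102635699174102590736576008567020694,
  846672649002509415211798058251096839574,
  6741122115725689931343779186193309352251140757473,
  1513712225340240479353062611564544839393,
  8128406872850538565134912611065035534378605369313,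
  1741757761395000062203966524251991363297,
  1091019994258963747970659196716172625889,
  19578364425967395091655577100932692348629003525099164106011,
  7755626810490180127336020138899416747445104594070,
  3972271348470181903472581476481084837193249902305,
  1563641209985818604963855106137042634721,
  5440284606551210289071555895419296854458677249430,
  13653742273997461938707113176761547784007587658374814611620,
  107299152473311751625032853272968542449029790018526412811355876373865,
  20813561440716844467757253362929102073266663670470162732324,
  139957652966878063508202528731708945562445114800903814808056658277737,
  118893628269547166343719440435712036162958124244644596873807284037272,
  19385988809680808461630726893629921939945127984959386929833,
  4937523888849049137935753252573056394912247461225,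
  4971768077320664592223591695422859629421024656041,
  23268857535292930159817713244542119718675241475584154286761,
  25031612495346494286320022704401009198656357136011902989673,
  6553782483482173189144488225451243054784130726569,
  25472929305456587125884593682611980612177822887979184437929,
  6353353599843222428041321879218454337892717806953,
  6346606448118624465189814056914471796066743201051,
  1219354973554308702509715374328541587236,
  1953898840920245233770296039926284892814,
  671928289556221553580181153253261377263082649820291147113641989468211057210701,
  8408157177507225132797251449057161520852647988961,
  5086425964214829435505416648650381118679251368590,
  11919995696605177151216969581092567191414793297404759619117143702179910899416076223535396183823585,
  34054946238708869915260347393071821522347999293780115995305,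
  8180085517762641326029888720482364044031541859620,
  1221342299786818055302216109014022837540,
  1774310232553464464398336579789898339620,
  1682627291538330651628407566335714671273,
  7472306034849644294226741470390691215373737014633,
  1801900774851203764399363697435861792077,
  985840290938575540203197146332608020260,
  1724609303406933353285446153493420158304,
  1214635926314457096522134499223476555489,
  2065180238448574059088196164304635641636,
  1981648752042289242291143029979862713552,
  1994588006476371945334190779295895628704,
  1572945805880179174769689566777363320545,
  628422168692545116906796514782063972044971928149395094736217359854877759630302,
  8618784775676146963627871346887772980659483027867,
  1235903574095368095692709575141022682849,
  1915870443349938996809199887584064040740,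
  1545015832650668340479835906915087105828,
  1185231305088548449738788921898720509732,
  1199621887654885662071409045919540102548,
  1458909124064252570525502960910197423456,
  1567905819801869784271075600718695070624,
  291708573907643929757129878432,
  1444594641222240777834971992845149982433,
  1051890703033313041422113110960954329057,
  1211398062534176183623041522771243486945,
  34155760203405594780503602330295586377446120945268716914310,
  2111864823313468389103391699010914537185,
  1860059053063360057466797534590286876385,
  167268337171601307674097687105183989070419522368968559122741252712925,
  5072252359703151688937174427206574297568341110043,
  1856653048242980686981768375480005349089,
  6983922611209749819037966173304077227498645700457,
  922208038775091361519885840404065179617,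
  1963741108202288430506997124522062798561,
  1476493841524937544755926932260591945697,
  1994588006461792291715032121030978284448,
  5611196842819121106664500648835283658533567645318,
  2070661027232777945032327628697324144609,
  1752975536142385259396195796048768379617,
  7164042332563106828412526415677469038073784194246,
  139709643777520887682328613805062894361872371278602820863460799370465,
  1146914618733829039180316706449762269348,
  1994955549124018518872491195776166483169,
  1894895906665890027664394291434851499360,
  1675716435705876629014462249215743094564,
  8416879294353935701212463955036174220501749808105,
  8184187874938530916460407294194020539317305310112,
  1769673820926455384216974161305787879137,
  7651963559842810512975241693157576738114108864996,
  1911153667594502929542265952425120288481,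
  1485636832338033148389020551385262538532,
  1133091487150911035009298691792128802144,
  2117013315217531938798467584278619963172,
  8466150787394682196782769727022156661098829825697,
  9008415729281841239329508381674806678274951828772,
  7541437887365057125541496821048704346015454053737,
  3196551495466585337677274840716651305938136757070356397222491687410183997662525559328661,
  8274183795470709870320485510583224017210040860521,
  1801012349484096829285320120744220216470,
  39313417815563010744014024711911127812866332563112929213417,
  2031531736045947239616212951056207498977,
  427538635016704150894741269408,
  8908050072048950763056606663900559895078800902113,
  8919468053584699850849733007664219033602981808097,
  33478355738895961163842100492705871987810424188290096351201,
  32423998803899677827561731842185908148851209738147765835745,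
  9162546589364956242219077463340254302136668441750,
  4923977144660482584921386082797734259309593676950,
  39696075049908496609977122367497540817034404251439252555158,
  5045551856884803101068700448511293237459614879457,
  579114560549356031482977850730356979535051173334936453451204671527578338483677,
  9010811906151823138717933963477759355942899207905,
  26946846836710823020587713427772664923419211613970907149673,
  8785383668541020603023174990684604644221062625961,
  1930639642930930224222974688232010394528,
  153181355041218597115409453443015293651456225708046374080069076466665,
  34826527534087466992092879701043623253958849408876138938148,
  36704685656221228438605614554275613382674360926893307250070,
  467661093688312702265498442381438564953373699162161321334817991475140297149590,
  25251673770738843389744021813986013668532243098408406468257,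
  9103684492024846092192549298244833376154619696353,
  1331799907197366862409770950387129890980,
  7946543446945404924583141233097261856867628307748,
  134481624708573694179355548311423037786819185798261477660161847507101,
  132480713662458641754916458180462284537924189279370511110847432672926,
  8830910465392103677662250366591128437056410178852,
  9057289206876182249932597447031840304700683958436,
  1863073444926313330692715198964173358753,
  4978101031344906858793434014853605128127981173417,
  1409570910227150591219013045467370204064,
  4999235844451261892047483019080000737859566283163,
  5725988578593279304226930483665907902055823850153,
  1335841790913185413192550464125159750313,
  8403495494422743935275873147828277780448957547881,
  5769633881128660728562596531964614696515994342625,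
  1580274464160011883240494612057975306921,
  5063735893442945605573582612262828718606111357609,
  9184204446519961308528063216578021512541311056036,
  167595795390873125106869338909397527276232789609954801313396215347605,
  1254185012596678477402426108312113856361,
  1502773647956103295335015588890022226848,
  9065748179975833716428911836661782102012568679785,
  38416193587681337461145941491171282212509342168471794046177,
  2056285636200921213468388514769682709161,
  5708092513801851524733487170804238576073225779364,
  2119943302033963670085403710327283894953,
  9286966280076982331923913749502547656570467498148,
  6584322526813709784814261925817943270626645720937,
  790781320602910504688370909096425607163275348968748606738374388469959953927645,
  147528447901952606198083051716814378931266826413850135020025403030185,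
  7153236271965034861543325060976826440608544048489,
  6125617933448176967954274765376436678288278668649,
  2098820932055516031070330971045654051497,
  1570969868285733485073672894500377838953,
  39023402480501121734499505655659146379151641213791358138532,
  6059907763609673161434716958142229583364417891611,
  96554824036127189951102228300391579575187682886638153721050337625761,
  8556215461580465425124057005550843465571265107236,
  37536776112625743449544316536838352200651825768049487526569,
  1826150124499764961589715215333130221732,
  27679141466371307940654964743072224741959770099952362436772,
  2097455464468626806900941894564540527950,
  803495564159755980205034269463667426467432749704561600634219922864569412407188,
  459076016309916667039439281889,
  2301365019178215775367963474365906603745,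
  8626155890739367865022508310579339540759806854505,
  474405010903788810379596527623633827830228830659191553280560894786051474176164,
  8112346721822333732223624770999208331428050384233,
  8659785871577581493165597701916466694124304480937,
  6222670776048404829565266178724224374226894600873,
  2197168292815383751817614176995004332169,
  31384953918796453669880961824026307343215858330549360642729,
  5988359611879779661694935133651394267992519325860,
  29273560153120422792945843041853961993457451910062971405673,
  2040299192970593237747000564356469999265,
  2272239879592397827069170329613102841184,
  706362922445241873905584054920047949308816902810830614776828482471565120454436,
  14208892838696382244563173939397500002974913539392852070244622921531230339457446987138709908022488,
  10820465264798446131735414702169947742327242606004016927629622539710707964633594158790671511304356,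
  7860527163906821910925857217273293060268447644329,
  2167940787790837360053043672490591533737,
  1655771200758364263871789439148213616420,
  25131330401734927003847805399484121359880941801008046520484,
  2175770877945785630811024408266634283689,
  7729844339892826970851847229950136156972520191337,
  24957429388322045690310723041689822565241654638904228140324,
  6912650540438122404174364028531143228046188198052,
  508897218812202078364585376228,
  2364630291674419995335326898496411482766,
  9892782749410013407148713331631139261141371828388,
  829234193311661061643139044921663880416951158464269981581976528683649045781982,
  8979479598236809733434052305718608731757944388265,
  8220048453213029147645632878311818860281317537956,
  174277786861384969366889554677483213405160647966474030041404352091428,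
  6124985127370968816286027469985356474932969461028,
  30718468768198858099450263292354364474146003153683144853353,
  7049841632236455451373243960647201291394845889828,
  6159104004625171278430968884746974513402233144991,
  140062965264235244142720223998385033999393864908504862734043517434537,
  9893309299174255500164386076742976497603631888548,
  42540479748523343308551251404339490949013610886448796907684,
  42587258089901403543246934132779116391612658896826101381284,
  9213124875734802847291987330861204447963361496801,
  43076419835315241752498696758711149455015329712961424641761,
  123162219754558203926400398212763817941385680853419157985216305801621,
  37536776111998378428258486528545742404554864505097551492457,
  7324263453119673703861742958726429595653526501540,
  9630169174119599516381676844691620291258371495204,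
  7096146364012366064617846794221374954119257245033,
  9148633059266643083220946651352947574705869011108,
  1450155398417609095172964511136205096297,
  164378819514685329349989547209412012892118903936648636352361039578783,
  847123166144840861489241551950591051933262279423482158812450227525175272720031,
  9573201985140912138323160553973850641028182001513,
  3521806575591189844450281013904788887159572212014497298652737737508633371325852532262559,
  13340456308826919969154413648910751170038962153484466778576184674076759750892336127378038217102628,
  850739023827002765915073232220357062704753294264197135395830968853584555100009,
  191548774910335860503764056075638990917168053946162445142887124253033,
  169746844255188211097488216855741371699485795348183662397338070530212,
  41658762121920331963822241989332415219130862578200758569641,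
  1951276624595843686649250287144547531433,
  7266792123469977817662261342886614711753422813865,
  170460832939516883299235906869780266307107200731458629829610018395361,
  2219633130309548018582404213871705209513,
  134785840584202952008212128789236298272893205649274721193671890974057,
  5526164145538210290057142182538347274141117069993,
  7615040560716200788014288440701193417520473294185,
  7324505995600175869311656552587648110160393419433,
  44331476253309666587908672164551911022313579280545517288105,
  7609321813495629250818203878949090885739306693993,
  194404341176958478576780050723705355801990160637391715579045640583326,
  194614965760344632807415086113965511059779123265180339569998199175326,
  26058144307723019930507903006884967539948463935374514174116,
  12473164497813831594544355194339128791108556960752804427913777147875753850602690338785314989678635030536989942691240102146670486500136311400027428,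
  9657615773959008155470880159384598384521480223440460859465077088230693364928592509228027493639412716187302452120324202144535341913704123757876507,
  37341055122662028544982892392685881074383665199868408305207391148004012856563944488845640876137808338727467832577718412644997715629774194878110617850005142,
  841424636603614928157973044069684297180093550323670812237931093711521269026923021292035210629696096028766234190873574343246180983714522970848651249792609562733281138802509664,
  12628346310476839335431581157720563389675822935651073371709130284567653365954920608238678603224638793827664454302431394011513915994146943104444273,
  2777681609331249354821615105949870614129268701273872818784202136931296967773950900234090425561804278440988135705041533295367177964349105,
  686567193089492898602641878708135366151959401254838027663282600315945661569101458895268144156477272363727708012796678338241777,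
  162647650793432877936898355335438102743472747039094133847418415885481682683006485851125324422562451599459115659945649,
  6315095758283328013829230949447492034517021837288813772161244677494517000756254326453475336963743,
  143595956297944154169005900137805605279700600081673989094590976676288088166897356080949558561716928238819540215412145,
  38083813875471716077363382049837577807382555208845333385189900881908112010051070258809230072017592545852593,
  30100798755884316084515506334067485428798617999382056335723688876956033264109425816130940479015110578187569,
  6382643871274306843075186522062598827291900090072732979529158805751974701796514569565842689410710,
  162433357440898284115446464002079175409050212169723200380580938772615745880014038687230815090926174133157807676604273,
  225927895589877550955275348526441890481841415206948494720495077674407198920868005354274116315778473790223019936404527072072120735531086162091355300789175519953960817,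
  101119034242238346751835031476626843446777854081569063075255006040782906331833721066162643731473288887092290427655561663694486,
  2817430602055511903980719286917134946276497480510098909847216919469128149269555372559313475623732998516244436245025200650404160912113521,
  709106237644324578416975122136730714224840465453751991701924603794323376884771992722871901203420864680668405612870167003021169,
  149718867508771666894166922024749475456362949865595900453549790153349023776432885792780963266888828353336961500702385,
  601543574668932062882724744577675198213429927609597094396742964359494375678414455659106906931436096730795898206311476205537120,
  965129644558743807131291577215869997040531164316350077909497980613442038504774108261207643261148004758301686145380356439618043306019049252665495940580389351921331730979220209,
  1044128009846330186703037434862426931675129439482733729831832424639471280088830526715061894498714954014292469460855155361483336463185145649257855916632690003489271737543288689,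
  13056312626136475867776467623045584849435779329850708461751726856299789239898509897628750987286262250324076563917719536210121377563087443273676465,
  226453441329643578643031940074595336053513522794589985645464471492380768576407081897380414266318711216075350536690071226897297507960789944162771880144428995383125681,
  710283708284825646475167489369942551209007448924614764856761182397055693333518961223439476858743453452191953395023883621623473,
  38584069832382708964474523795015628776646127102037704581190721748152335859693605001567283406986641010845361,
  38683736559039569747198704946773292678386663298620619010132940372982325267095970411295468689601740189984433,
  36255294141592666043244906600093304641024372906997061469412878906428022364176430522131476127240702859142833,
  38872762867862558433494329192475263077155277627683783300878824787844598446631784089870947791711236932232881,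
  1938339006822068230678482737273730892734438449371492147378090934492929531924761322993896279070904575557859716996046195837681108895655601,
  11011157454416627997047307634164408899068748944740315301417966956837308324509887239352392891459963744401706882660096340216763330308771230070163296,
  12544340918906283079518780243833963392954878429053298049832980936595719136423242717403660960170076085087780619008631234938376378907692891349706417,
  167838438364661356770965011753836282004913949428027384584216991571342475386177307848849329673945398298813885221955249,
  3101751145778864271593758576698990691504513230926846111429005195841454512507808028280553901083887418391141302723233931354574026974684849,
  13422614037854146249394998615031851342686322191521818177698145502618920983303663929584265688371085533369920585705076308661723656087560804682425649,
  3113773506508017309624677543612622877208545789558296661894434268532958283285676834130984155370047628978261003659675646076881415429125809,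
  985153154058271556510509456629909367317563834408515511003460286784850619108419519213030661609601732376659786252365746450864096482104187675270267128908342455521134451874850481,
  150291969439470395812441123312958314309719628054142176780242731215473976887030719452912511640447803620350780832474801,
  9208949552776846377923976863285364347517826190069798230313776547290639332311453273055259950048945,
  673571261585678437131430795163081581891263891561642988400982565786961380340398663059450479954332526475485553490019634252758193,
  26683122848266390386975922441648442019616130873666227149403577420416661383663944523846325647157750713462001,
  11912249075911473691317703090967417736658117837767716023240952616207981410579931592014268247375820315391894207963462191714174208811749426226681057,
  40099019286835022737219005461778905973096993311058103941207028177340691459682585535064811907543447289871537,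
  3197955603365312392907478657257224885095196513702598499042789029219790262029235365655319740096415423277254959089011014120527627514107825,
  40233080805102654804252680052500607238085998779460974514394936859710827749492280492204619672018202933476529,
  3210262498542547047752662279148866514225414587292648965190203281134188052008193519259100870124657937188828041725174161641208525427566257,
  116453660035647640106337652359010928680234146575183061543266983178386944044035792120098798578555625204143239784818865,
  12422889958981247910641557162271623902846062944309336525204788562519962476774412895896440749887870246480392493134508593487452156391270726105445809,
  40726774185256377721452223971734024484595801604735512742319282004424544427876261787916646058434968411403569,
  40805896613212678870685628169940095735457364683545931765538793628515116134604222176471785496326111567400113,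
  635023468181561436868209676425628954594902219365167261134803861362066715509920881155961028273585377317813196660190408167304433,
  12523089968533398275738627426206605632982015362777036276594129790524661409798697022987885231257171709696860204761038479116879714122817823846550705,
  3233751039932206783504639730765095633631482825096329840935072273845799043733058447638891085870564473726176404094675801001449526245866673,
  3233751039859816802366408452953890684672051137259652782118373914695742343127649201501291921550633177127130913898312355901721557782584561,
  3238813544815782121379157778899300104723349838211813834440546499519486296707381296081351501503430698930651352648587445356310628991989041,
  3250055767395514682094110524526413899455860005361826732677392249151226875763630141309838625845139923987930312166086779250439419947007153,
  160781706118229771953442211739816786941954173915457209088573133837434728222564691271571782835559357165279176396367537,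
  11791281667033843006830117783729239247534890695112314965439674420846843554517749532847799532584908715399512374640023641415968354427175374217537905,
  698709746586744502431971022156385475939719993364506861784920588356110204996671584384094515841026296905562391429434263003719345,
  646904964740572988572306363700175067792489991655059248558867420575879463844675828838789147512028023665008489629026330514548401,
  718149001789271040596977115163866835608428664190758345922367593478020153393394082804257235116766632631837892749700774867124081,
  719589065051147706734794924575783230722681725111270536046773763333518396872093686006116763748053149253736211678900467317073585,
  2665947179635291447737725091219979854228530672872032532171777682454764048901947719465416005272346771778402638161637686387635945872111968,
  61000431959980989468719137392203787194256942043064143391692637406896481779641302300144164335678914139508497340121707745731699927964952562221874511894953137,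
  9544535670430984635853985470630545606881272547437952821040257696092933409780966547298921318367633294986965526590378542981974354383858640764128433,
  14141777345388595363050732988914820036492694946652425722151621811751507885709445434546612010705487972779061119379932946233874400670598596129973937,
  767949397971718569500290599662565136084005519608344332377848653418122330390637774044238709656574365358324781890272028263704241,
  3295438911540427704308919790373188768635337097674624506059165622686204134022998071725857457410285165093131474552183860475466838854330033,
  14211514508981322311837616117654568089580829168858503973294140328021675017751361768551451159390472653207023031640844280144815545805778315433995057,
  243015070289346208577000878047042128133269971491275727095282867876812541629895661990191876951179827117309354583610420820347189807906998066314432221712980858614572721,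
  1620347064913421116421384665340103798423096874215030513388399873201578062830657421102595709086777657985727405292979802156207975003551601,
  180787348073663003791569951668726993102194079542036521771056588453256123849062289061222584357333797473214322428341041,
  3323209819409165957953599337217269870459824391573215350765447204220786154376503225400405718424482509910099054760681544880414838844287793,
  969371722065885505922633837351470154509711488140361546923402764981465300234394064685575593675816528583426594964256340738781456154154874155428324194858504124531377726696602801,
  42083110373158202588012792961544623572383039842789970502927979129452836467457685756204296858824395786545969,
  777856058401530998420914905508530002431399830090261421926644008883435310711771168942352146800861189129643682792770404042925745,
  972771933207477995595853875338401666148787300997174622493087694393378002301848071167636945831984999448031994790240363962303115166402736221435352903702398748672690669074957983,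
  3090065480240733139079809818779099428321745803559602147025346828882999752771065663568749701559262555974769893926413333926306883155781297,
  3193266639850990228126058593667751246303321040845805051658260290430607710341238843214572617340439399780836228671140211512920264351643313,
  13205993303329549381716285640065187686669606894649230271267965478852660242292464285173730146367577667463572183145057276572358166951909262070376113,
  237287535355075637427492433863203860186036521232204494026012414382754381311404617810928876606929263221120753552883276301050515670460332116648546018544775173997712676,
  167258596109146926563435152505583297760490477772022730366170733893326214233625517802442921948477238850251399091185329,
  13274666654801037414363250942449112540690557030836016130658284842243446387668987099062216096427946840283927217570476362817258160897015323645175473,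
  124169129110922051595488668650032525219867424566207805346015368945006781644922052760441204331255481978328544699475633,
  13522686402846300715950405529084332234760610335029120797870955812336708146125553095650231644870602772511291262538612802979469283554690373940143793,
  12471646439750400967688791922444680312628251927137274121182237851233410945892037397020606461680931493798212536701455375865700405789755418076688113,
  49739968265672616567423254583615875869898931144181383046334832795460943366305036760002646294444580634734475063102221006920787115591708021809736040569890481,
  3146735123026908929316851374585836134626897080982275219363379712615779062463425032560473764731213800064608192314013014172400295478181041,
  36722607913502540859598629618510706697386986684337266620634404860210652157825041270517748594963146966558385,
  170651183306191269474538871181208205573255864548349584718922131138558659053437936411625955011719440009375414408701617,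
  59652177831298084190469794478752239447414800132588123624710421306345288601745655836566885842017905561825739702860791577452036452662696072606311216510891249,
  9922559909221526170362922708174232980256206680739443310452123237180848059897375081511258616564776050461466404927242271148704069817312567793433777,
  734236673278042765110187497950417124707822122979752003021794058452793327424394857644890692860342334092453147927737766386067121,
  174652949561018268346442823603367340248624858016492271708974657109103573409306666336194539273502469736445713654736561,
  3928357742479123993739771908929509835254006971646065722957198743780801381966619707326873958294385060622350553333198856421836971125053821369021172133415916308495876842434840441660369649,
  187581732845143387518258113871763575847696398230789649678592894016782854058273806283913552145331725234583137208755889,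
  52829232249770862329042938382192907291568061431085418504718698035694800093130490851118430824957100622918460757831108545347045989155013507104727053672376497,
  750128706513892962449269591935429399153429736780711909618091410355979694420127347152467534810136564997314720685322520147963185,
  853407328632340808091188107769968869308981321264321579605996170516902436134167412992159963337328691522251091665901879545146139,
  290624849912737204618354306654764233874257435302627417642433058122707437136912271540448128883781928953050251361695815856240129347040839831765480711998400292670064277,
  189265910308010094646739091566379553371922894435206245182731187945611686718756143498877712466805273935423975766091953,
  14958797473771423843703550368083126775399447086514149798256213364446742284080025310335376124598863237679811811684755651761523103438927474095023793,
  769933695607023722250446539705947971712668534371862167715089113317459607545630342056972204871801926109364603295938836106570545,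
  39695542067037137999592445229821924878461366977274966373672749802539619414014993415238291945101940655093425,
  3278443052899334596222810328871780569024323316346299240526797137537486061751563678646320118675969853866471360811317780181280911487657201,
  227362306206010211765330187194989653790832762885325903138632166095980744484194424858963373039872466570745305946374888468655701584060119222374503590380043408386206129,
  13620744133633641673153740066549325806312788279364121873389189995083491913585748329940774164424053052149816391912506189571983643643146329818478944,
  261469699003101118552581937743993361500306061600562168905933101235953277154572793097572041412959060051049135248808949308464923404275205151714367819439792917069575601,
  768601274772650004931096148379239046577402117028444247443630223765843168203795605985648151651704997161267502954522509647013105,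
  13693814707540379871288728690931080952699959977823710596524565952575638679666984419901369418969052858225495205237197419030562584590664169214883990,
  61837513700728779306260015050422657419122615343219065527013116441865623811657293996593653678649950791869912011403323285290531119957336677048225450165528241,
  191885113030416429546319405175300332912767273500055408033548607682904408314290723160162689112776032911188068358677745,
  248273173233383235619769792125722271954615164762719781929841047610434118841165224135860681081024633576258128371682659453980097266659142123953995953005502218808555185,
  438083599193672021194487227753610935123989531815462097927408347941935059749387924155242982821780506020636511135864689941538033,
  180129926418236456963497290566684978026671784119762632288523359120240656145718643189600835671971434097476484661241073,
  1039122501003027605183051796339805173111402625034315726005088747584027443745561255796911397670759699615803232586770570929637485440836599337070413292898076840167376507024958705,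
  3281401751400772019493592860589201420861508163909446888593921812988700481107328981746493762636547494649526223285298298197031841449633457,
  72797321791775935549059256080113100894392715593585406722481540318968164988880824571769789470389655428051403328272736,
  3413926979812804295782278594079843288437876520460700519255073273960127976174794405166638918110507793444376532066657651245303036967381169,
  14544211084315884964596622116478570903590893042426411118736729168153870619111193190553697446917700637943966226370425929056073271112414812259477169,
  196758862028558249872056532462292123873792437027171383593220797719572269934915871290220625495842006331815029040474289,
  1158106274501308954616684376995039092021454156413397497677498119979914112681739453162548129290529666842571498800302469220654025646936680664929943761956768881106645496496383665,
  56719926110018041894123698929741731423685205587416325320619478000313777021738592984064325632971219551656412951813784662045183872121578355441111997783554400,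
  176185876184400129031163379821815406855982106699609020203050170817148543912168579047273117186999925309214464467527345,
  791527344132305441727019437975993915333337162989980428768941997407267942884666415767773460480587838077059936022437549303283569,
  14506617031806326888559769712780762554149925883666983955963589539314888151207025247048706244194492767290223821785769460004823799986976200343829681,
  10001615251540604414561990253256760200665480654007748788558205913946386823215639911477864927061233,
  42373159367710343298027772421143194426933908053368018892116621174072584989174113566593425304401513077270193,
  2300726378551035040502877771974537652985047737449027902752765417749665543515608504854193,
  773308083424336843340900105197953236361163117287395505098104759412856340873218396579875566963846143721959454033472476792743601,
  537665520716034705034975045104415571070016105285455507487189713801819821696689,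
  3346703668052544104344776133599646763643142415864807024952657368317159971942492900491889400622448256167680426660572489924688739457820337,
  52841378600480334467984705219433124751913735324012095464915818160251488016774139334156171450556754150284520601885003218003121383464371239257767297173505888,
  183881580522134165828262605755860553140906312677609592976583752072355532561921322885193861259743034139092979451159793,
  64123247201265604320319196252587205204310767172358221581467822404163982293090285605119895526391149528197833945940232277313728881654364904197018367013676721,
  14371585886548419637452985785635866139756632171940371509614845685897361886279140922849526852762681052023995992456297094111827619100515898997336241,
  180345370555807965784568698484701220473858071737709491820466688994332232588787783602255008231285475371800174894769841,
  682518227854829911981699206663701027347358768943589787050749087909428282953820734613065987596192126456072690898318587753391793,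
  3216099834750268666618220354950008644874884987309716685483651115927755678626724762894446205904119706212778496920146575041645511372433073,
  61538368273236077502694175996584841547594657675773820323563461151701386605174200642026878610898926060531946455555491545324535564338710193580363295984535392,
  64751738198140189853848709139609431358634254876556749258122193040503666264023744637493225407948795204073930719594803711242453873934802525679720689051749553,
  234101594777645666104850072636162225481855299159941398013564120816801706888673452908059354253249408204180310499325761624905999755971371225578846838706055389751162289,
  1024820388591453958541542658296167311583599864131279656579591928526738305161625120121932180744302446747983272043503414619639261011626260252722789334590372399372999619360581297,
  814875192669882366880521386740333583118318612137910305881716358800356114222435512853099717585887678734110975329370904985068785,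
  43754282707385679414691446731272052640851413026821268447124329039488175297961206080078160498377882384721585,
  61951940120390648304878627869814198827401847051297582365169118646158393512627482477502315273907408678425756553840481443050823978178447611703610601218422943,
  62061700999237221508027369679191473127465248735694213159321402544904400057361901424087416200885131661808660495672680138171068250296919363969630378598774934,
  66030385026895334796341399962419705100886684072242602264180297793942149560872881594504473935602545625564688280469724558144464715783365245209034444141459121,
  3590871199855391079460109025315279507446588361537313142676360216850533298093021114216899857731401854961150121577279705824700870648777905,
  47754702630801810332932534166712241206801011466620345482819595101313231882020713468003046112237252348128497,
  15568534826816687908485489727369705763580360210316203050022436763952067458332333965953720295902012638513410156690662024557044384047758189835205809,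
  216115021726129102628329529429369419725450987634449931025381169264760020607729229312165349999932147241166576402680525215129643157011837145820747050819161200355037041,
  846393859826311801438020683056601858357448100861778212004386617374953494410193579454228581590061305080004220943111920992300273,
  65925726030481055118127257400350952689633000241501894756921531468261248696003742719223676545670535811318008379188624732467113816594198406672648937305159089,
  639447472481926242843714698902960532605504451403248358055872247430953963802998541924208755884162983701466899777449474832379121,
  3647655474947853257239921435122422428685793773380619249453646111079259706300540243725475114116616455376211576857255742126801421493456753,
  3818013153408048630145250987623864364682363995393562908131042409080999843456844354157582821377931785732435832161731745456585239074614513,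
  1235660505888574857330573581787840820674688971567228021925780021019548510522350845439237022563740757456794598143672278713781405187712574186013826891405329174920832182864398176,
  581840829764138174195771830398417551652150360949225488298765133080512961963697,
  44345811269133148892869655284583796480113620515630277758067991710414729992811416489605568161094959510054577,
  11261499595671007001352839081647158329140706204522299966647575832742772872135366581172540510824113,
  10569323682861331895297549847872133670600217826807805087146351824239598980431270057820187903911601,
  849012523457154374995055026716013665606907675564290173661002649326690860364234143569169939429738668069609475182927950759585969,
  3415509470213960867967592333260185454349730273106144809266165684196258617102231484159549242738356596075122175150300223899203384926426328,
  210354803439170590706012207318762842975748903207838511329819314500198233576625953549262777610778388212794607506440049,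
  11370318821157336162115959166215044797648677566837735270393189239738017505018381308735979049445041,
  10784188264373122351613914136670893324584893742147697852084340146933366494714190836979326042760433,
  45819953597379660224570297520319636862414987541071659071685342952029416291256966605527835608196715686388977,
  3739169983667746560199619276303930985906801425772255537437206320658113245735151212612921118399308586534605879567045693688348858125993824,
  3914546421499739401271154730396350846479392506063624630920379023062865784982246521925500269878156287578304620968311593458151387775071921,
  194661517792631722347006263856013294450372341764449272891233112442133586511903624982166812443966562384785456432932529,
  11445397856602912098677823187496396406933660471687155014996454024670866413574470385224071326721713,
  3429695683077519737292526345677896506535272975277622504757494833471563985923596037205213623682993529612092049694850896637698037408941920,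
  49764875587036407994107207816703522852752637455585452235579776409483808507481681283760340843259282213562033,
  15649132241150787825478776758372883379586518270367256287440057945282171072333348587342715739148316273050045378084192879847581619327813458925075633,
  214046341296626771482915317331882433872785974249860158717803598454381250241617391154782786809458160918517741918349489,
  3655069019963832472390300137681069380884221124911459720758028875468235527972190920512979494953824199360466909837659465234252569003681457,
  17668001947080964511562852142508513496819767768165695811275413832965275432378100372411878333574399506827078383347009692413328255512832371058456735,
  213276507842709178990781740427434157809489938167195753542901265184131537039508006858578221943692977520063874541283505,
  275546743177456641691002628942676156981917249274191034546036771335879706128624205254120611494571419505354867118773253235208578241817571658941459705303412994415090929,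
  16296114252276043037893858501130346284366900503783197400174487542851551106938141039612005965691630496502212923768535435933890229476828917473208177,
  66670416803496874910436273407228192203896195583678775286591956043919182604450664104544880340846436834991012166655760069109216275949363695138520238404921521,
  230193165995604358934579877544958317457643498868212604287071478187225350608199821179454270313787950633109685594706322051076088755626915487772121009548413382006110385,
  3259348998040725046877268593839316688697524757113341486821264402803841139988217015772944671642990504443730396616570931541852867704498971,
  199520701137750251620174094530431002489653318427242462169679238518740947817362008817799523608172279159033873011565809,
  14596293160875619463594030054804268498359402365705726852933273151836695192456306051981526476303953340252769655701459670003482546996080060743108448,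
  11695371962608509065320056928754632215447589730162239366732850858984922038031627803802252139030193,
  3999297587179175619018858983166195931074815134055374073688810870012196349950740952178015018317705633884170950962421630678941694258570929,
  201119958237149818927920919937144387891432617945409706701238800825552115341974233914837527790925524306414101312300721,
  12300946656444005656087306304390162982083395172196322340916307431957208627450527672377143480601472331340133347010339907106632826322478412772665009,
  2546336547374096276684566430095856317978575532025639579220048522611022832402606478059185,
  47373710211578131264457095374680814147623470434802948431577758598264744185246608085305599706247153567313137,
  73532253263936007896640148368507590627864392339926041161258730629145971476458780845778363881680627818796583115913035351288756977799143079208678500419156117,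
  2740528321798976969316869735426620988437084351804375854411870159051913702324256388671153,
  17274406985708256812160306410802824933425316421784218788148817218341263840518795052384210386588701574570545093347130404680232387363933372814685873,
  11851222990657598668101848744077401808983868918212328795310518075759375328138014316333133919405229028433862172348608991567631154503070104042825617006347245141105152792762265883805373870850561307,
  203257916987969548347502443208061844366020172614783298475727235654698660088912728464491374026302664547649542054733489,
  7001250335370843790672477502619834186339769521585259590457695495167438580667228884687196545576421317355906617702018080828442606623800089790899622490376012528619392191245939258965656472160548132,
  129725673235552699974485912968399384071391975306309101699903952453640542279713194037312344941911978744941523967060455995696395948984241324663509294400297246834752992651701960612577757444561198674816986201531219121,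
  128528073252666033438878129865597748751938951130852437858791837289001394674544739326819119473480917897474812443620465383876582810052669915903330665735549862686257805698462081174304296156489829954264204817837798752,
  128492756144712486650035861696523016752868918154599906850156149708028891595957592454407038224469686718834875094391402653648141451973696342027637406961191185176433669647175871779211306050069485136011025152889828644,
  129148113547725323185614605327992598213462110413885114852141284347409360725575563776918222847212338975001448976570793184618211574127223560066665921678539625258248024872905367467107778034995306755116350536989259044,
  6962949320337909117199651763540407196821034043877231525850614882997340609582171161271216362573243271831646548928389206884404381143615219337335741441898308801738098967441531924491093210591114673,
  127218245099818442156711542982889093755953091914264630619901446226011829595910728170761901528777383879320890715155901017986404830644756105421006472816382755958904551313596892850308968587117184353888491031624103195,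
  133747756449672886643838791682038096708910226514328336480638596459818568233671892989803864438009434484223731421770389472297323070685235164310239541953483657067866653870246740110494960564973224552922105720541001065,
  133796162747237880468064444941120255680156194049432924686507857908080362782271167450452622400131684463440380136681288625165636083367924334035867252080538099195362484373822050420194394641189072454702657145755261075,
  135101583937682024820920799208933045017506901471448600988033891943967769710299789660798161045377131732460545180043284836595258899885718486780546010187410888602335092095341579175942252650755094362707086598714026656,
  125202370768019503248493733397110137270571443507349847748106994979468522615285603813575501698314413788060483274074463113973368109154085024904731853779521392551225504904629386497609452274977679888630053402869856484,
  125896346104614068352017157390145684392401841949415513245922875043793946645202537333197757249267517607948338918508165535540970887020691390852776250395307594174670608793277855710229125097574877646718749884307073696,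
  134361967622725350322542849626479413036999222742860785175546767689746078410347670325918310741393902425378300252273587398908344567314668456681174627367505061875545629901145988513794498175495428547541596272692690097,
  124547724446799086654356744616741861969170712748895432152334096401936904402559250916240904657567047173151114515296332344906696496297375294480416339158576233101082886545111691237878584876979420615119624262118782244,
  135677001598724305385421046658157400749075375221766845219108299760178036276653506400373927650776196033824613567743016028098476061763516913269612367461288087187063453687724568272068479600177207641285219545976536241,
  128528143482444814608029900865935335466739899469968250700849824444946271654618822573322457527371582728310951703789959420753355826006079494268212386660077909849692873540340390690259157518996992648660837372443964768,
  124547724448023288311851453131952512530826280981120847806810130114784126567755265554100635009455361093195123780664506619275773030669397870595034237249150701101970614637131190022134740644063958426648326094791768228,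
  125156729791035370346677912024508928374935717274622685085007346043587227943903951402452479866925098237796749339939321738105353982209734007495403412672187835763835066136086674762197827794261011795895386039601200305,
  123890207460253196571592554185360481322321479841496182134985530530559566251746396176510649153374032419524296791639584676794346416098312385007109764572740672489080300081380087313143016328663828667338108277362129060,
  127833079570348074814213155985157547687729595365067084187845508376851680918877457551448692511253045748228054468568921333112591009425131411742292179534452380807472760315929018156791903267702220721735942061059078308,
  125485488285264868949436468601775002275487572605496624107343119397593087040961129242184048859892961284871648724161915251594725365133996763647022594982818507555354696749649992679107855202760013314922008232714173617,
  126518045595420251747883966569876896696910316586794976784668105651716080072846598721824011707821951751761679015691828120628138630995115592160280358058725044184139062542347097464021173360397345394186151234758899876,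
  125860528607420524852491470797548994132197959075140940286206806564286043758803833634034978665871344857544512302556253293177465946835762871582593444122158201898980215950944705719106453923755259410471302999500633380,
  125862688191488858240447152024263174735655840829937798738230742793572683706843115402331498020599021519147311916057799244486227793239652654446807574566508079451339991458435869266916208455640494502232847234763306276,
  134445726139611452871668854545209125505429084904813774587757503140386169956680502326222320524773271132406985231490927766939024652317991757478169431957257755661209630617354834342665258029174272843494456510255412576,
  7675950593717059748995965446380595733739067879820327919327221082690445542688154967889625787408699815966479464556960897873838641240547234285291889016565329374559699262365944799033884412199697585,
  131122824093955253198730097040220437366050899696732463947748302827018628674465237091437957819520143683698141687479816926544666541626145761481126112504092866385461330240973127707269902684950416666956504707737564452,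
  129807790118568159821759451266528825867868266802084336388323955507704719798067721735023966511298483969593841692888711292833057202279089869032527713361447370603837739012982190740949538867947096369324612031253820708,
  123186391086959149872172598565879777702532825477290758674433333865192429572402253351649432214038675886544666412463506062223938211250388547864017015679930926148293795396136229708232453152918724993040937489376869553,
  123515149580805923216214762130575757865624166254626993301235972863515643019222796269369816666743331767744409086816336614339240699613612617606961262228892678332977886357031487115730662891429711095238195038099995825,
  6858674065729851021082910064313208597940215784124966433271453287033578483350069568785396164687588230583011972404732596895597139906587482693574618890879122826572576917132499054688247774589614244,
  369420449662143214343707814038595793664455752510359476965076194793714720298626834980106781972792930453766670135000649330004136749389336592541125749019686937598502700799013723636230655542108699148293515333693718161217564068776357216,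
  369691051830400581903632133171607908807714986647514058361750873567605213781492104652462680955480779468584411487672718255865812011705247993149192936164134794672116754269690168990820814585190076365338152751831657695042646002244103451,
  344688679191420591209824661329710540513710429497971157822128963954787413651154931578770439929458247852248191063730018016761124456862318324807341758881094751120586591703210613367626148475848014761391674512047756444388145820700393119,
  357467431098593007545387750482634300165449513283789614540066261677284613996860424046093661946024782706073312523033051603136614863871981160091938862732371345900343853232189426038900125624288853907108122740047457886234967312446893408,
  707053205972528360999976721016746982670179394348509507470433883820539302059486930032296403445688490113577387521818372225468089302420909641889204907160474209956710114463661010476529573952742170613956610967425897797246472608330520288162790586094185216]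

theorem certifies_rows : certifies rootBoard rows startTable = true := by decide +kernel

theorem slot_startTable (k : ℕ) : slot startTable k = if k = 0 then startTable else 0 := by
  rw [slot_eq]
  cases k with
  | zero => decide +kernel
  | succ k =>
    have h : startTable < 2 ^ (150 * (k + 1)) :=
      lt_of_lt_of_le (by decide +kernel : startTable < 2 ^ 150)
        (Nat.pow_le_pow_right two_pos (by omega))
    rw [Nat.div_eq_of_lt h]
    simp

theorem startTable_mem_pathSets {W : Finset V} {u v : V} {f : ℕ → V} (hf : IsLabeling W u v f) :
    edges f 0 startTable ∈ pathSets W u v := by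
  have h01 : edges f 0 startTable ∈ pathSets W (f 0) (f 1) := by
    refine ⟨[0, 2, 3, 4, 5, 6, 7, 1].map f, ?_, rfl, rfl, ?_, ?_⟩
    · have hlt : ∀ a ∈ [0, 2, 3, 4, 5, 6, 7, 1], a ∈ Finset.range 8 := by decide
      exact List.Nodup.map_on (fun a ha b hb h => hf.injOn (hlt a ha) (hlt b hb) h) (by decide)
    · have h8 : [0, 2, 3, 4, 5, 6, 7, 1].toFinset = Finset.range 8 := by decide
      rw [← hf.image_eq, ← h8]
      ext z
      simp only [List.mem_toFinset, List.mem_map, Finset.mem_image]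
    · have hmem : ∀ t ∈ edgeList, startTable.testBit t.1 = true →
          s(f t.2.1, f t.2.2) ∈ edges f 0 startTable := fun t ht h => mem_edges.2 ⟨t, ht, h, rfl⟩
      simp only [List.map_cons, List.map_nil, List.isChain_cons_cons, List.isChain_singleton,
        and_true]
      refine ⟨hmem (2, 0, 2) ?_ ?_, hmem (6, 2, 3) ?_ ?_, hmem (11, 3, 4) ?_ ?_,
        hmem (19, 4, 5) ?_ ?_, hmem (32, 5, 6) ?_ ?_, hmem (49, 6, 7) ?_ ?_,
        Sym2.eq_swap ▸ hmem (30, 1, 7) ?_ ?_⟩ <;> decide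
  rcases hf.ends with ⟨rfl, rfl⟩ | ⟨rfl, rfl⟩
  · exact h01
  · rwa [pathSets_comm]

theorem startTable_winning (W : Finset V) (u v : V) : Winning W u v startTable := by
  have h : ∀ t ∈ edgeList, startTable.testBit (t.1 + 50) = false := by decide
  refine ⟨fun f hf => .of_subset (startTable_mem_pathSets hf) _ _ _ subset_rfl, fun f _ => ?_⟩
  rw [Finset.disjoint_left]
  intro e he
  obtain ⟨t, ht, hb, -⟩ := mem_edges.1 he
  rw [h t ht] at hb
  cases hb

theorem edges_rootBoard_subset {W : Finset V} {u v : V} {f : ℕ → V} (hf : IsLabeling W u v f) :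
    edges f 0 rootBoard ⊆ pairs W \ {s(f 0, f 1), s(f 2, f 3)} := by
  intro e he
  obtain ⟨t, ht, hb, rfl⟩ := mem_edges.1 he
  obtain ⟨-, h1, h2, h3, -⟩ := edgeList_lt t ht
  have hW : ∀ i < 8, f i ∈ W := fun i hi => by
    rw [← hf.image_eq]
    exact Finset.mem_image_of_mem f (Finset.mem_range.2 hi)
  rw [Finset.mem_sdiff, mk_mem_pairs, Finset.mem_insert, Finset.mem_singleton]
  refine ⟨⟨hW _ h1, hW _ h2, fun h => h3 (hf.injOn ?_ ?_ h)⟩, ?_⟩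
  · simpa using h1
  · simpa using h2
  · rintro (h | h)
    · rw [hf.edge_injective ht (s := (1, 0, 1)) (by decide) h] at hb
      revert hb
      decide
    · rw [hf.edge_injective ht (s := (6, 2, 3)) (by decide) h] at hb
      revert hb
      decide

theorem exists_isLabeling {W : Finset V} {u v x y : V} (hW : W.card = 8)
    (hnd : [u, v, x, y].Nodup) (hsub : [u, v, x, y].toFinset ⊆ W) :
    ∃ f : ℕ → V, IsLabeling W u v f ∧ f 0 = u ∧ f 1 = v ∧ f 2 = x ∧ f 3 = y := by
  set l := [u, v, x, y] ++ (W \ [u, v, x, y].toFinset).toList with hl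
  have hlW : l.toFinset = W := by
    rw [hl, List.toFinset_append, Finset.toList_toFinset, Finset.union_sdiff_of_subset hsub]
  have hlnd : l.Nodup := by
    rw [hl, List.nodup_append']
    refine ⟨hnd, Finset.nodup_toList _, fun a ha ha' => ?_⟩
    rw [Finset.mem_toList, Finset.mem_sdiff, List.mem_toFinset] at ha'
    exact ha'.2 ha
  have hlen : l.length = 8 := by
    rw [← List.toFinset_card_of_nodup hlnd, hlW, hW]
  have hget : ∀ i (hi : i < 8), l.getD i u = l[i]'(hlen ▸ hi) := fun i hi =>
    List.getD_eq_getElem _ _ _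
  refine ⟨fun i => l.getD i u, ⟨?_, ?_, Or.inl ⟨rfl, rfl⟩⟩, rfl, rfl, rfl, rfl⟩
  · intro i hi j hj h
    simp only [Finset.coe_range, Set.mem_Iio] at hi hj
    simp only [hget i hi, hget j hj] at h
    exact (hlnd.getElem_inj_iff).1 h
  · rw [← hlW]
    ext z
    simp only [Finset.mem_image, Finset.mem_range, List.mem_toFinset, List.mem_iff_getElem]
    constructor
    · rintro ⟨i, hi, rfl⟩
      exact ⟨i, hlen ▸ hi, (hget i hi).symm⟩
    · rintro ⟨i, hi, rfl⟩
      exact ⟨i, hlen ▸ hi, hget i (hlen ▸ hi)⟩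

end PathGame

theorem winsWithMissingEdge_eight (V : Type*) [DecidableEq V] : WinsWithMissingEdge V 8 := by
  intro W u v x y hW hnd hsub
  obtain ⟨f, hf, rfl, rfl, rfl, rfl⟩ := PathGame.exists_isLabeling hW hnd hsub
  have hD : ∀ k, PathGame.slot PathGame.startTable k = 0 ∨
      PathGame.Winning W (f 0) (f 1) (PathGame.slot PathGame.startTable k) := by
    intro k
    rw [PathGame.slot_startTable]
    split_ifs
    · exact Or.inr (PathGame.startTable_winning _ _ _)
    · exact Or.inl rfl
  exact (PathGame.certifies_makerWins _ hD PathGame.certifies_rows hf).mono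
    ((PathGame.edges_rootBoard_subset hf).trans Finset.subset_union_left) subset_rfl

theorem theorem4 (n : ℕ) (hn : 336 ≤ n) :
    (∃ C : CliqueCycle n,
      (∀ i, (C.W i).card = 8 ∨ (C.W i).card = 9) ∧
      C.graph.edgeSet.ncard ≤ 4 * n ∧
      (∀ i, MakerWinsSecond (edgeBoardOn C.graph (C.W i))
        (fixedHamPathSets C.graph (C.W i) (C.a (i - 1)) (C.a i))) ∧
      MakerWinsFirst (edgeBoard C.graph) C.parallelSets ∧
      MakerWinsHam C.graph) ∧
    mHat n ≤ 4 * n := by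
  obtain ⟨C⟩ := exists_cliqueCycle (n := n) (by omega) (by omega)
  have h := winsWithMissingEdge_eight (Fin n)
  have hcard := C.ncard_edgeSet_le (by omega)
  have hham := C.makerWinsHam (by omega) h
  refine ⟨⟨C, fun i => ?_, hcard, C.makerWinsSecond (by omega) h,
    C.makerWinsFirst_parallel (by omega) h, hham⟩, ?_⟩
  · rw [C.card_W (by omega)]
    split_ifs
    · exact Or.inr rfl
    · exact Or.inl rfl
  · have : mHat n ≤ C.graph.edgeSet.ncard := Nat.sInf_le ⟨C.graph, hham, rfl⟩
    exact this.trans hcard
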